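/- Let $R$ be an excellent normal local domain with maximal ideal $m_R$ and quotient field $K$, let $K'$ be a finite field extension of $K$, and let $R'$ be a normal local ring with quotient field $K'$ and maximal ideal $m_{R'}$ which lies over $R$, that is, $R'$ is the localization of the integral closure of $R$ in $K'$ at a maximal ideal. Then the completions $\hat R$ and $\hat R'$ of $R$ and $R'$ at their maximal ideals are domains, the induced map $\hat R\to\hat R'$ is injective, and, writing $E$ and $E'$ for the quotient fields of $\hat R$ and $\hat R'$, the extensions $E'/E$ and $(R'/m_{R'})/(R/m_R)$ are finite. Put $$d(R':R)=[E':E],\qquad g(R':R)=[R'/m_{R'}:R/m_R]_s,\qquad r(R':R)=\frac{d(R':R)}{g(R':R)},$$ where $[\,\cdot:\cdot\,]_s$ is the separable degree. Then $R\to R'$ is unramified (that is, $m_RR'=m_{R'}$ and $R'/m_{R'}$ is a finite separable extension of $R/m_R$) if and only if $r(R':R)=1$. -/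

import Mathlib

open IsLocalRing

universe u v w

/-! ### Excellent rings -/

/-- A Noetherian algebra `A` over a field `k` is geometrically regular if `L ⊗[k] A` is a regular
ring for every finite field extension `L` of `k`. -/
def IsGeometricallyRegular (k : Type u) (A : Type v) [Field k] [CommRing A] [Algebra k A] : Prop :=
  ∀ (L : Type u) [Field L] [Algebra k L] [FiniteDimensional k L],
    IsRegularRing (TensorProduct k L A)

/-- A ring is catenary if for all primes `p ≤ q` the chains of primes from `p` to `q` have bounded
length and all the saturated chains have the same length `n` (which is then the bound). -/
def IsCatenaryRing (R : Type u) [CommRing R] : Prop :=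
  ∀ p q : PrimeSpectrum R, p ≤ q → ∃ n : ℕ, ∀ s : LTSeries (PrimeSpectrum R),
    s.head = p → s.last = q →
      s.length ≤ n ∧ ((∀ i : Fin s.length, s i.castSucc ⋖ s i.succ) → s.length = n)

/-- The completion of a local ring at its maximal ideal. -/
abbrev LocalCompletion (R : Type u) [CommRing R] [IsLocalRing R] : Type u :=
  AdicCompletion (maximalIdeal R) R

/-- The formal fibres of a local ring `A` (the fibres of `A → Â` over the primes of `A`) are
geometrically regular. -/
def HasGeometricallyRegularFormalFibers (A : Type u) [CommRing A] [IsLocalRing A] : Prop :=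
  ∀ (p : Ideal A) [p.IsPrime],
    IsGeometricallyRegular p.ResidueField (p.Fiber (LocalCompletion A))

/-- An excellent ring: a Noetherian ring that is universally catenary, a G-ring and J-2. -/
class IsExcellentRing (R : Type u) [CommRing R] : Prop extends IsNoetherianRing R where
  /-- Every finite type algebra is catenary. -/
  universallyCatenary : ∀ (B : Type u) [CommRing B] [Algebra R B] [Algebra.FiniteType R B],
    IsCatenaryRing B
  /-- The formal fibres of every localization at a prime are geometrically regular
  (here `A` is any model of the localization of `R` at `p`). -/
  formalFibers : ∀ (p : Ideal R) [p.IsPrime] (A : Type u) [CommRing A] [Algebra R A]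
    [IsLocalization.AtPrime A p] [IsLocalRing A], HasGeometricallyRegularFormalFibers A
  /-- The regular locus of every finite type algebra is open. -/
  isOpen_regularLocus : ∀ (B : Type u) [CommRing B] [Algebra R B] [Algebra.FiniteType R B],
    IsOpen {p : PrimeSpectrum B | IsRegularLocalRing (Localization.AtPrime p.asIdeal)}

/-! ### Local rings of a finite field extension -/

/-- Let `R` be a ring contained in a field `K'` and `R'` a local ring with quotient field `K'`.
Then `R'` lies over `R` if, as a subring of `K'`, it is the localization at some maximal ideal
of the integral closure of `R` in `K'`. -/
def LiesOver (R : Type u) (K' : Type v) (R' : Type w) [CommRing R] [Field K'] [CommRing R']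
    [Algebra R K'] [Algebra R' K'] : Prop :=
  ∃ n : Ideal (integralClosure R K'), n.IsMaximal ∧
    ∀ x : K', x ∈ (algebraMap R' K').range ↔
      ∃ a b : integralClosure R K', b ∉ n ∧ x = (a : K') / (b : K')

/-- If `R'` lies over the local ring `R`, then `R'` dominates `R`. -/
theorem LiesOver.isLocalHom {R : Type u} {K' : Type v} {R' : Type w} [CommRing R] [IsLocalRing R]
    [Field K'] [CommRing R'] [Algebra R K'] [Algebra R' K'] [Algebra R R'] [IsScalarTower R R' K']
    (h : LiesOver R K' R') : IsLocalHom (algebraMap R R') := by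
  obtain ⟨n, hn, H⟩ := h
  refine ⟨fun x hx => ?_⟩
  by_contra hxu
  have hmax : (n.comap (algebraMap R (integralClosure R K'))).IsMaximal :=
    Ideal.isMaximal_comap_of_isIntegral_of_isMaximal n
  have hxn : algebraMap R (integralClosure R K') x ∈ n := by
    have h1 : x ∈ n.comap (algebraMap R (integralClosure R K')) := by
      rw [eq_maximalIdeal hmax]
      exact (mem_maximalIdeal x).2 hxu
    exact h1
  obtain ⟨y, hy⟩ := hx.exists_right_inv
  have hxy : algebraMap R K' x * algebraMap R' K' y = 1 := by
    rw [IsScalarTower.algebraMap_apply R R' K', ← map_mul, hy, map_one]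
  obtain ⟨a, b, hb, hab⟩ := (H (algebraMap R' K' y)).1 ⟨y, rfl⟩
  have hb0 : (b : K') ≠ 0 := by
    intro h0
    apply hb
    have h2 : b = 0 := Subtype.ext h0
    rw [h2]
    exact n.zero_mem
  apply hb
  have h3 : b = algebraMap R (integralClosure R K') x * a := by
    apply Subtype.ext
    change (b : K') = algebraMap R K' x * (a : K')
    rw [hab] at hxy
    field_simp at hxy
    exact hxy.symm
  rw [h3]
  exact n.mul_mem_right _ hxn

section Dominating

variable (R : Type u) (R' : Type v) [CommRing R] [CommRing R'] [IsLocalRing R] [IsLocalRing R']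
  [Algebra R R'] [IsLocalHom (algebraMap R R')]

/-- A local homomorphism `R → R'` is unramified: the maximal ideal of `R` generates the
maximal ideal of `R'` and the residue field extension is finite separable. -/
def IsUnramifiedLocalExtension : Prop :=
  (maximalIdeal R).map (algebraMap R R') = maximalIdeal R' ∧
    Module.Finite (ResidueField R) (ResidueField R') ∧
    Algebra.IsSeparable (ResidueField R) (ResidueField R')

theorem maximalIdeal_pow_le_comap (n : ℕ) :
    maximalIdeal R ^ n ≤ (maximalIdeal R' ^ n).comap (algebraMap R R') := by
  rw [← Ideal.map_le_iff_le_comap, Ideal.map_pow]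
  exact Ideal.pow_right_mono
    (((local_hom_TFAE (algebraMap R R')).out 0 2 rfl rfl).mp inferInstance) n

/-- The map `R̂ → R / m ^ n → R' / m' ^ n`. -/
noncomputable def completionMapAux (n : ℕ) : LocalCompletion R →+* R' ⧸ maximalIdeal R' ^ n :=
  (Ideal.quotientMap (maximalIdeal R' ^ n) (algebraMap R R')
    (maximalIdeal_pow_le_comap R R' n)).comp (AdicCompletion.evalₐ (maximalIdeal R) n).toRingHom

theorem factorPow_comp_completionMapAux {m n : ℕ} (hle : m ≤ n) :
    (Ideal.Quotient.factorPow (maximalIdeal R') hle).comp (completionMapAux R R' n) =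
      completionMapAux R R' m := by
  ext x
  obtain ⟨x, rfl⟩ := AdicCompletion.mk_surjective (maximalIdeal R) R x
  simp only [completionMapAux, RingHom.comp_apply, AlgHom.toRingHom_eq_coe, RingHom.coe_coe,
    AdicCompletion.evalₐ_mk, Ideal.quotientMap_mk]
  have h := congrArg (Ideal.quotientMap (maximalIdeal R' ^ m) (algebraMap R R')
    (maximalIdeal_pow_le_comap R R' m)) (AdicCompletion.Ideal.mk_eq_mk (maximalIdeal R) hle x)
  rw [Ideal.quotientMap_mk, Ideal.quotientMap_mk] at h
  exact h

/-- The map `R̂ → R̂'` induced by a local homomorphism `R → R'`: the inverse limit of the maps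
`R / m ^ n → R' / m' ^ n`. -/
noncomputable def completionMap : LocalCompletion R →+* LocalCompletion R' :=
  AdicCompletion.liftRingHom (maximalIdeal R') (completionMapAux R R')
    (factorPow_comp_completionMapAux R R')

theorem evalₐ_completionMap (n : ℕ) (x : LocalCompletion R) :
    AdicCompletion.evalₐ (maximalIdeal R') n (completionMap R R' x) =
      Ideal.quotientMap (maximalIdeal R' ^ n) (algebraMap R R') (maximalIdeal_pow_le_comap R R' n)
        (AdicCompletion.evalₐ (maximalIdeal R) n x) :=
  AdicCompletion.evalₐ_liftRingHom (maximalIdeal R') (completionMapAux R R')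
    (factorPow_comp_completionMapAux R R') n x

theorem completionMap_algebraMap (x : R) :
    completionMap R R' (algebraMap R (LocalCompletion R) x) =
      algebraMap R' (LocalCompletion R') (algebraMap R R' x) := by
  refine AdicCompletion.ext_evalₐ fun n => ?_
  rw [evalₐ_completionMap, AlgHom.commutes, AlgHom.commutes]
  exact Ideal.quotientMap_mk

variable {R R'}

/-- The map `E → E'` between the quotient fields of `R̂` and `R̂'`. -/
noncomputable def completionFractionMap [IsDomain (LocalCompletion R)]
    [IsDomain (LocalCompletion R')] (h : Function.Injective (completionMap R R')) :
    FractionRing (LocalCompletion R) →+* FractionRing (LocalCompletion R') :=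
  IsFractionRing.map h

/-- `d(R':R) = [E':E]`, where `E` and `E'` are the quotient fields of `R̂` and `R̂'`. -/
noncomputable def completionDegree [IsDomain (LocalCompletion R)] [IsDomain (LocalCompletion R')]
    (h : Function.Injective (completionMap R R')) : ℕ :=
  letI := (completionFractionMap h).toAlgebra
  Module.finrank (FractionRing (LocalCompletion R)) (FractionRing (LocalCompletion R'))

variable (R R') in
/-- `g(R':R)`, the separable degree of the residue field extension. -/
noncomputable def residueSeparableDegree : ℕ :=
  Field.finSepDegree (ResidueField R) (ResidueField R')

/-- `r(R':R) = d(R':R) / g(R':R)`. -/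
noncomputable def ramificationRatio [IsDomain (LocalCompletion R)] [IsDomain (LocalCompletion R')]
    (h : Function.Injective (completionMap R R')) : ℚ :=
  (completionDegree h : ℚ) / (residueSeparableDegree R R' : ℚ)

end Dominating

/-!
Let `S` be the integral closure of `R` in `K'`.

Regular local rings are normal and normality ascends along flat maps with normal fibres, so `R̂` is
a normal domain. The same holds locally for `R̂ ⊗ S`, whose zero divisors are therefore separated by
idempotents. Since `S` is finite over `R`, the map `R̂ ⊗ S → R̂'` is surjective and its kernel dies
in the localization at the preimage of the maximal ideal, so `R̂'` is a domain, finite over `R̂`.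

To see that `S` is finite, one uses the openness of regular loci to reduce to the localizations of
`R` at finitely many primes of height one. For a discrete valuation ring `A` with integral closure
`T`, the module `Â ⊗ T` is finite modulo the maximal ideal and is separated because it is reduced.

For the degrees, lift a primitive element of the separable part of the residue field extension to
`θ` in `R̂'`. The residue of `θ` is a root of the reduction of the minimal polynomial `p` of `θ`, so
`g ≤ deg p ≤ d`. In the unramified case Nakayama's lemma gives `d ≤ g`. Conversely, if `d = g`, then
`p` reduces to the separable minimal polynomial of the residue of `θ`, so `p'(θ)` is a unit and
Euler's formula gives `R̂' = R̂[θ] = R̂[X]/(p)`, from which unramifiedness can be read off.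
-/

open TensorProduct

/-! ### Regular rings -/

section RegularLocalRing

variable {A : Type*} [CommRing A] [IsLocalRing A]

theorem exists_span_insert_erase_eq_maximalIdeal [DecidableEq A] {s : Finset A}
    (hs : Ideal.span (s : Set A) = maximalIdeal A) {x : A} (hx : x ∈ maximalIdeal A)
    (hx2 : x ∉ maximalIdeal A ^ 2) :
    ∃ y ∈ s, Ideal.span (insert x (s.erase y : Set A)) = maximalIdeal A := by
  obtain ⟨a, -, ha⟩ := Submodule.mem_span_finset.1 (hs.symm ▸ hx : x ∈ Ideal.span (s : Set A))
  obtain ⟨y, hy, u, hu⟩ : ∃ y ∈ s, IsUnit (a y) := by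
    by_contra! hcon
    refine hx2 (ha ▸ pow_two (maximalIdeal A) ▸ Ideal.sum_mem _ fun y hy => ?_)
    exact Ideal.mul_mem_mul (hcon y hy) (hs ▸ Ideal.subset_span hy)
  refine ⟨y, hy, le_antisymm (Ideal.span_le.2 ?_) ?_⟩
  · rintro z (rfl | hz)
    · exact hx
    · exact hs ▸ Ideal.subset_span (Finset.mem_of_mem_erase hz)
  · rw [← hs, Ideal.span_le]
    intro z hz
    rcases eq_or_ne z y with rfl | hzy
    · have hmem : ↑u⁻¹ * (x - ∑ i ∈ s.erase z, a i • i) ∈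
          Ideal.span (insert x (s.erase z : Set A)) := by
        refine Ideal.mul_mem_left _ _ (sub_mem (Ideal.subset_span (Set.mem_insert _ _)) ?_)
        exact Ideal.sum_mem _ fun i hi =>
          Ideal.mul_mem_left _ _ (Ideal.subset_span (Set.mem_insert_of_mem _ hi))
      have hxz : x - ∑ i ∈ s.erase z, a i • i = u * z := by
        rw [← ha, ← Finset.add_sum_erase s _ hy, add_sub_cancel_right, smul_eq_mul, hu]
      rwa [hxz, Units.inv_mul_cancel_left] at hmem
    · exact Ideal.subset_span (Set.mem_insert_of_mem _ (Finset.mem_erase.2 ⟨hzy, hz⟩))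

instance isLocalRing_quotient_span_singleton (x : maximalIdeal A) :
    IsLocalRing (A ⧸ Ideal.span {(x : A)}) :=
  have : Nontrivial (A ⧸ Ideal.span {(x : A)}) :=
    Ideal.Quotient.nontrivial_iff.2 (mt Ideal.span_singleton_eq_top.1 x.2)
  .of_surjective' (Ideal.Quotient.mk _) Ideal.Quotient.mk_surjective

variable [IsNoetherianRing A]

theorem spanFinrank_maximalIdeal_quotient_lt (x : maximalIdeal A)
    (hx2 : (x : A) ∉ maximalIdeal A ^ 2) :
    (maximalIdeal (A ⧸ Ideal.span {(x : A)})).spanFinrank < (maximalIdeal A).spanFinrank := by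
  classical
  obtain ⟨s, hcard, hs⟩ := Submodule.FG.exists_span_finset_card_eq_spanFinrank
    (IsNoetherian.noetherian (maximalIdeal A))
  obtain ⟨y, hy, hspan⟩ := exists_span_insert_erase_eq_maximalIdeal hs x.2 hx2
  let π := Ideal.Quotient.mk (Ideal.span {(x : A)})
  have hπ : maximalIdeal (A ⧸ Ideal.span {(x : A)}) = Ideal.span (π '' (s.erase y)) := by
    have hx0 : π x = 0 := Ideal.Quotient.eq_zero_iff_mem.2 (Ideal.mem_span_singleton_self _)
    have hmap := congrArg (Ideal.map π) hspan
    rw [map_maximalIdeal_of_surjective π Ideal.Quotient.mk_surjective, Ideal.map_span,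
      Set.image_insert_eq, hx0] at hmap
    exact hmap.symm.trans Submodule.span_insert_zero
  calc (maximalIdeal (A ⧸ Ideal.span {(x : A)})).spanFinrank
      ≤ (π '' (s.erase y)).ncard :=
        hπ ▸ Submodule.spanFinrank_span_le_ncard_of_finite ((s.erase y).finite_toSet.image _)
    _ ≤ (s.erase y).card :=
        (Set.ncard_image_le (s.erase y).finite_toSet).trans (Set.ncard_coe_finset _).le
    _ < s.card := Finset.card_erase_lt_of_mem hy
    _ = (maximalIdeal A).spanFinrank := hcard

theorem exists_notMem_sq_notMem_minimalPrimes (h : maximalIdeal A ∉ minimalPrimes A) :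
    ∃ x : maximalIdeal A, (x : A) ∉ maximalIdeal A ^ 2 ∧ ∀ q ∈ minimalPrimes A, (x : A) ∉ q := by
  have hmin (q) (hq : q ∈ minimalPrimes A) : ¬ maximalIdeal A ≤ q := fun hle =>
    h (((maximalIdeal.isMaximal A).eq_of_le hq.1.1.ne_top hle).symm ▸ hq)
  have hsq : ¬ maximalIdeal A ≤ maximalIdeal A ^ 2 := fun hle => by
    have hbot : maximalIdeal A = ⊥ := Submodule.eq_bot_of_le_smul_of_le_jacobson_bot _ _
      (IsNoetherian.noetherian _) (by rwa [smul_eq_mul, ← pow_two]) (maximalIdeal_le_jacobson _)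
    exact h ⟨⟨inferInstance, bot_le⟩, fun q _ _ => hbot.le.trans bot_le⟩
  have hfin := minimalPrimes.finite_of_isNoetherianRing A
  by_contra! hcon
  rcases (Ideal.subset_union_prime' (s := hfin.toFinset) (f := id) (a := maximalIdeal A ^ 2)
      (b := maximalIdeal A ^ 2) fun q hq => (hfin.mem_toFinset.1 hq).1.1).1 (fun x hx => by
    simp only [Set.union_self, Set.mem_union, SetLike.mem_coe, Set.mem_iUnion, exists_prop,
      Set.Finite.mem_toFinset, id]
    exact or_iff_not_imp_left.2 (hcon ⟨x, hx⟩)) with hle | hle | ⟨q, hq, hle⟩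
  · exact hsq hle
  · exact hsq hle
  · exact hmin q (hfin.mem_toFinset.1 hq) hle

end RegularLocalRing

section RegularLocalRingDomain

variable {A : Type*} [CommRing A] [IsRegularLocalRing A]

theorem isRegularLocalRing_quotient_span_singleton (x : maximalIdeal A)
    (hx2 : (x : A) ∉ maximalIdeal A ^ 2) : IsRegularLocalRing (A ⧸ Ideal.span {(x : A)}) := by
  refine .of_spanFinrank_maximalIdeal_le _
    (ENat.WithBot.add_le_add_natCast_right_iff (c := 1) |>.1 ?_)
  calc ((maximalIdeal (A ⧸ Ideal.span {(x : A)})).spanFinrank + 1 : WithBot ℕ∞)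
      ≤ (maximalIdeal A).spanFinrank := by
        exact_mod_cast spanFinrank_maximalIdeal_quotient_lt x hx2
    _ = ringKrullDim A := IsRegularLocalRing.spanFinrank_maximalIdeal
    _ = (maximalIdeal A).height := maximalIdeal_height_eq_ringKrullDim.symm
    _ ≤ ringKrullDim (A ⧸ Ideal.span {(x : A)}) + 1 :=
        Ideal.height_le_ringKrullDim_quotient_add_one x.2

variable (A) in
theorem isDomain_of_isRegularLocalRing : IsDomain A := by
  induction hn : (maximalIdeal A).spanFinrank using Nat.strong_induction_on generalizing A with
  | _ n ih =>
  by_cases h0 : maximalIdeal A ∈ minimalPrimes A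
  · have hdim := IsRegularLocalRing.spanFinrank_maximalIdeal (R := A)
    rw [← maximalIdeal_height_eq_ringKrullDim, Ideal.height_eq_zero_iff.2 h0] at hdim
    have hbot : maximalIdeal A = ⊥ :=
      (Submodule.spanFinrank_eq_zero_iff_eq_bot (IsNoetherian.noetherian _)).1
        (by exact_mod_cast hdim)
    exact (isField_iff_maximalIdeal_eq.2 hbot).isDomain
  · obtain ⟨x, hx2, hxq⟩ := exists_notMem_sq_notMem_minimalPrimes h0
    have := isRegularLocalRing_quotient_span_singleton x hx2
    have hdom := ih _ (hn ▸ spanFinrank_maximalIdeal_quotient_lt x hx2)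
      (A ⧸ Ideal.span {(x : A)}) rfl
    have hprime : (Ideal.span {(x : A)}).IsPrime := (Ideal.Quotient.isDomain_iff_prime _).1 hdom
    obtain ⟨q, hq, hqx⟩ := Ideal.exists_minimalPrimes_le (bot_le (a := Ideal.span {(x : A)}))
    have hqp : q.IsPrime := hq.1.1
    have hqm : q ≤ maximalIdeal A • q := fun y hy => by
      obtain ⟨a, rfl⟩ := Ideal.mem_span_singleton.1 (hqx hy)
      exact Ideal.mul_mem_mul x.2 ((hqp.mem_or_mem hy).resolve_left (hxq q hq))
    have hq0 : q = ⊥ := Submodule.eq_bot_of_le_smul_of_le_jacobson_bot _ q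
      (IsNoetherian.noetherian _) hqm (maximalIdeal_le_jacobson _)
    have : (⊥ : Ideal A).IsPrime := hq0 ▸ hqp
    exact .of_bot_isPrime A

theorem exists_prime_mem_maximalIdeal (h : ¬ IsField A) : ∃ x ∈ maximalIdeal A, Prime x := by
  have := isDomain_of_isRegularLocalRing A
  have hmin : maximalIdeal A ∉ minimalPrimes A := by
    rwa [IsDomain.minimalPrimes_eq_singleton_bot, Set.mem_singleton_iff,
      ← isField_iff_maximalIdeal_eq]
  obtain ⟨x, hx2, -⟩ := exists_notMem_sq_notMem_minimalPrimes hmin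
  have := isRegularLocalRing_quotient_span_singleton x hx2
  have hx0 : (x : A) ≠ 0 := fun h0 => hx2 (h0 ▸ zero_mem _)
  exact ⟨x, x.2, (Ideal.span_singleton_prime hx0).1 ((Ideal.Quotient.isDomain_iff_prime _).1
    (isDomain_of_isRegularLocalRing _))⟩

end RegularLocalRingDomain

open Polynomial in
theorem pow_dvd_of_eval_scaleRoots_eq_zero {T : Type*} [CommRing T] {x : T}
    (hx : x ∈ nonZeroDivisors T) (hrad : (Ideal.span {x}).IsRadical) {p : T[X]} (hp : p.Monic)
    {k : ℕ} {t : T} (h : (p.scaleRoots (x ^ k)).eval t = 0) : x ^ k ∣ t := by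
  induction k generalizing t with
  | zero => simp only [pow_zero, isUnit_one, IsUnit.dvd]
  | succ k ih =>
    have hmonic : (p.scaleRoots (x ^ k)).Monic := (monic_scaleRoots_iff _).2 hp
    rw [pow_succ, scaleRoots_mul] at h
    have htx : t ∈ Ideal.span {x} := hrad
      ⟨_, (scaleRoots.isWeaklyEisensteinAt _
          (Ideal.mem_span_singleton_self x)).pow_natDegree_le_of_root_of_monic_mem h
        ((monic_scaleRoots_iff _).2 hmonic) _ le_rfl⟩
    obtain ⟨s, rfl⟩ := Ideal.mem_span_singleton.1 htx
    rw [scaleRoots_eval_mul] at h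
    rw [pow_succ']
    exact mul_dvd_mul_left x (ih ((mul_left_mem_nonZeroDivisors_eq_zero_iff (pow_mem hx _)).1 h))

section RegularRing

variable {A : Type*} [CommRing A]

theorem isRegularRing_of_isLocalization_of_forall_disjoint [IsNoetherianRing A] (M : Submonoid A)
    (h : ∀ (p : Ideal A) [p.IsPrime], Disjoint (M : Set A) p →
      IsRegularLocalRing (Localization.AtPrime p))
    (B : Type*) [CommRing B] [Algebra A B] [IsLocalization M B] : IsRegularRing B := by
  have : IsNoetherianRing B := IsLocalization.isNoetherianRing M B inferInstance
  refine isRegularRing_iff.2 fun p hp => ?_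
  have := IsLocalization.isLocalization_isLocalization_atPrime_isLocalization M
    (Localization.AtPrime p) p
  have := h (p.comap (algebraMap A B))
    ((IsLocalization.isPrime_iff_isPrime_disjoint M B p).1 hp).2
  exact .of_ringEquiv (IsLocalization.algEquiv (p.comap (algebraMap A B)).primeCompl
    (Localization.AtPrime (p.comap (algebraMap A B))) (Localization.AtPrime p)).toRingEquiv

theorem isRegularRing_of_isLocalization [IsRegularRing A] (M : Submonoid A) (B : Type*)
    [CommRing B] [Algebra A B] [IsLocalization M B] : IsRegularRing B :=
  isRegularRing_of_isLocalization_of_forall_disjoint M (fun _ _ _ => inferInstance) B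

variable (A) in
theorem isReduced_of_isRegularRing [IsRegularRing A] : IsReduced A :=
  isReduced_ofLocalizationMaximal A fun P _ => by
    have := isDomain_of_isRegularLocalRing (Localization.AtPrime P)
    infer_instance

theorem isIntegrallyClosed_of_isLocalizationAway [IsDomain A] {x : A} (hx : Prime x) (B : Type*)
    [CommRing B] [IsIntegrallyClosed B] [Algebra A B] [IsLocalization.Away x B] :
    IsIntegrallyClosed A := by
  let K := FractionRing A
  have hle : Submonoid.powers x ≤ nonZeroDivisors A :=
    powers_le_nonZeroDivisors_of_noZeroDivisors hx.ne_zero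
  let _ := IsLocalization.localizationAlgebraOfSubmonoidLe B K _ _ hle
  have := IsLocalization.localization_isScalarTower_of_submonoid_le B K _ _ hle
  have : IsFractionRing B K :=
    IsFractionRing.isFractionRing_of_isDomain_of_isLocalization (Submonoid.powers x) B K
  refine (isIntegrallyClosed_iff K).2 fun {z} hz => ?_
  obtain ⟨b, rfl⟩ := (isIntegrallyClosed_iff K).1 ‹_› (hz.tower_top (A := B))
  obtain ⟨k, a, ha⟩ := IsLocalization.Away.surj x b
  obtain ⟨p, hp, hpz⟩ := hz
  replace ha : algebraMap A K a = algebraMap A K (x ^ k) * algebraMap B K b := by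
    rw [IsScalarTower.algebraMap_apply A B K, ← ha, mul_comm, map_mul, ← map_pow,
      ← IsScalarTower.algebraMap_apply]
  have hroot : (p.scaleRoots (x ^ k)).eval a = 0 := IsFractionRing.injective A K <| by
    rw [map_zero, ← Polynomial.eval₂_at_apply, ha]
    exact Polynomial.scaleRoots_eval₂_eq_zero _ hpz
  obtain ⟨c, rfl⟩ := pow_dvd_of_eval_scaleRoots_eq_zero (mem_nonZeroDivisors_of_ne_zero hx.ne_zero)
    ((Ideal.span_singleton_prime hx.ne_zero).2 hx).isRadical hp hroot
  rw [map_mul] at ha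
  exact ⟨c, mul_left_cancel₀
    (mt (map_eq_zero_iff _ (IsFractionRing.injective A K)).1 (pow_ne_zero k hx.ne_zero)) ha⟩

theorem isIntegrallyClosed_of_isRegularRing_of_isLocalRing [IsRegularRing A] [IsLocalRing A] :
    IsIntegrallyClosed A := by
  induction hn : (maximalIdeal A).height using WellFoundedLT.induction generalizing A with
  | _ n ih =>
  have := IsRegularLocalRing.of_isRegularRing_of_isLocalRing (R := A)
  have := isDomain_of_isRegularLocalRing A
  by_cases hfield : IsField A
  · let _ := hfield.toField
    infer_instance
  obtain ⟨x, hxm, hx⟩ := exists_prime_mem_maximalIdeal hfield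
  let B := Localization.Away x
  have hle : Submonoid.powers x ≤ nonZeroDivisors A :=
    powers_le_nonZeroDivisors_of_noZeroDivisors hx.ne_zero
  have : IsDomain B := IsLocalization.isDomain_localization hle
  have : IsRegularRing B := isRegularRing_of_isLocalization (Submonoid.powers x) B
  have hB : IsIntegrallyClosed B := .of_localization_maximal fun P _ _ => by
    have : IsRegularRing (Localization.AtPrime P) :=
      isRegularRing_of_isLocalization P.primeCompl _
    refine ih _ ?_ rfl
    have hPm : P.under A < maximalIdeal A := by
      refine (le_maximalIdeal (Ideal.IsPrime.under A P).ne_top).lt_of_ne fun heq => ?_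
      have hxP : algebraMap A B x ∈ P := Ideal.mem_comap.1 (heq.ge hxm)
      exact ‹P.IsMaximal›.ne_top
        (P.eq_top_of_isUnit_mem hxP (IsLocalization.Away.algebraMap_isUnit x))
    calc (maximalIdeal (Localization.AtPrime P)).height
        = P.height := by
          exact_mod_cast maximalIdeal_height_eq_ringKrullDim.trans
            (IsLocalization.AtPrime.ringKrullDim_eq_height P (Localization.AtPrime P))
      _ = (P.under A).height := (IsLocalization.height_under (Submonoid.powers x) P).symm
      _ < (maximalIdeal A).height := Ideal.height_strict_mono_of_isPrime hPm
      _ = n := hn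
  exact isIntegrallyClosed_of_isLocalizationAway hx B

variable (A) in
theorem isIntegrallyClosed_of_isRegularRing [IsRegularRing A] [IsDomain A] :
    IsIntegrallyClosed A :=
  .of_localization_maximal fun P _ _ => by
    have : IsRegularRing (Localization.AtPrime P) :=
      isRegularRing_of_isLocalization P.primeCompl _
    exact isIntegrallyClosed_of_isRegularRing_of_isLocalRing

end RegularRing

/-! ### Normality and flat extensions -/

section AssociatedPrimes

theorem mem_smul_top_of_forall_mem_associatedPrimes {S M : Type*} [CommRing S] [IsNoetherianRing S]
    [AddCommGroup M] [Module S M] [Module.Flat S M] (I : Ideal S) {m : M}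
    (h : ∀ q ∈ associatedPrimes S (S ⧸ I), ∃ s ∉ q, s • m ∈ I • (⊤ : Submodule S M)) :
    m ∈ I • (⊤ : Submodule S M) := by
  have hfin := associatedPrimes.finite S (S ⧸ I)
  obtain ⟨s, hsm, hs⟩ : ∃ s, s • m ∈ I • (⊤ : Submodule S M) ∧ IsSMulRegular (S ⧸ I) s := by
    by_contra! hcon
    obtain ⟨q, hq, hle⟩ := (Ideal.subset_union_prime (s := hfin.toFinset) (f := id) ⊥ ⊥
      (fun q hq _ _ => (hfin.mem_toFinset.1 hq).1)
      (I := (I • (⊤ : Submodule S M)).colon {m})).1 fun s hs => by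
        have hreg : s ∈ {r | IsSMulRegular (S ⧸ I) r}ᶜ :=
          hcon s (Submodule.mem_colon_singleton.1 hs)
        simpa only [← biUnion_associatedPrimes_eq_compl_regular, Set.Finite.coe_toFinset, id]
          using hreg
    obtain ⟨s, hsq, hs⟩ := h q (hfin.mem_toFinset.1 hq)
    exact hsq (hle (Submodule.mem_colon_singleton.2 hs))
  have hreg : IsSMulRegular (M ⧸ I • (⊤ : Submodule S M)) s :=
    (TensorProduct.quotTensorEquivQuotSMul M I).symm.isSMulRegular_congr s |>.2 (hs.rTensor M)
  rw [← Submodule.Quotient.mk_eq_zero] at hsm ⊢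
  exact hreg.right_eq_zero_of_smul hsm

open Module.associatedPrimes in
theorem maximalIdeal_mem_associatedPrimes_localization {S : Type*} [CommRing S] {f : S}
    {q : Ideal S} [q.IsPrime] (hq : q ∈ associatedPrimes S (S ⧸ Ideal.span {f})) :
    maximalIdeal (Localization.AtPrime q) ∈ associatedPrimes (Localization.AtPrime q)
      (Localization.AtPrime q ⧸ Ideal.span {algebraMap S (Localization.AtPrime q) f}) := by
  let φ : (S ⧸ Ideal.span {f}) →ₗ[S]
      Localization.AtPrime q ⧸ (Ideal.span {f}).map (algebraMap S (Localization.AtPrime q)) :=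
    (IsScalarTower.toAlgHom S (S ⧸ Ideal.span {f}) _).toLinearMap
  have : IsLocalizedModule q.primeCompl φ := by
    rw [isLocalizedModule_iff_isLocalization]
    infer_instance
  rw [← Set.image_singleton, ← Ideal.map_span]
  refine mem_associatedPrimes_of_comap_mem_associatedPrimes_of_isLocalizedModule q.primeCompl φ _ ?_
  rwa [← Ideal.under, IsLocalization.AtPrime.under_maximalIdeal _ q]

theorem isDiscreteValuationRing_of_maximalIdeal_mem_associatedPrimes {A : Type*} [CommRing A]
    [IsDomain A] [IsLocalRing A] [IsNoetherianRing A] [IsIntegrallyClosed A] {f : A} (hf : f ≠ 0)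
    (h : maximalIdeal A ∈ associatedPrimes A (A ⧸ Ideal.span {f})) :
    IsDiscreteValuationRing A := by
  obtain ⟨-, x, hx⟩ := isAssociatedPrime_iff.1 h
  obtain ⟨a, rfl⟩ := Ideal.Quotient.mk_surjective x
  have hmem (s : A) : s ∈ maximalIdeal A ↔ f ∣ s * a := by
    rw [hx, Submodule.mem_colon_singleton, Submodule.mem_bot, ← Ideal.mem_span_singleton,
      ← Ideal.Quotient.eq_zero_iff_mem, map_mul]
    rfl
  have hfm : f ∈ maximalIdeal A := (hmem f).2 (Dvd.intro _ rfl)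
  have ha : ¬ f ∣ a := fun h => Ideal.IsPrime.ne_top inferInstance
    ((Ideal.eq_top_iff_one (maximalIdeal A)).2 ((hmem 1).2 (by rwa [one_mul])))
  let K := FractionRing A
  have hfK : algebraMap A K f ≠ 0 := by
    rwa [Ne, map_eq_zero_iff _ (IsFractionRing.injective A K)]
  have hfm0 : maximalIdeal A ≠ ⊥ := fun h0 => hf ((Submodule.mem_bot A).1 (h0 ▸ hfm))
  -- Otherwise `a / f` maps the maximal ideal into itself, so that it is integral over `A`.
  obtain ⟨p, hp, c, hpc, hc⟩ : ∃ p ∈ maximalIdeal A, ∃ c, p * a = f * c ∧ IsUnit c := by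
    by_contra! hcon
    have hint : IsIntegral A (algebraMap A K a / algebraMap A K f) := by
      refine isIntegral_of_smul_mem_submodule (M := K)
        (Submodule.map (Algebra.linearMap A K) (maximalIdeal A)) ?_
        ((IsNoetherian.noetherian _).map _) _ ?_
      · exact (Submodule.ne_bot_iff _).2 ⟨_, ⟨f, hfm, rfl⟩, hfK⟩
      · rintro _ ⟨p, hp, rfl⟩
        obtain ⟨c, hc⟩ := (hmem p).1 hp
        refine ⟨c, hcon p hp c hc, ?_⟩
        rw [Algebra.linearMap_apply, Algebra.linearMap_apply, smul_eq_mul, div_mul_eq_mul_div,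
          eq_div_iff hfK, ← map_mul, ← map_mul, mul_comm a, hc, mul_comm]
    obtain ⟨c, hc⟩ := IsIntegrallyClosed.algebraMap_eq_of_integral hint
    exact ha ⟨c, IsFractionRing.injective A K
      (by rw [map_mul, hc, mul_div_cancel₀ _ hfK])⟩
  have hspan : maximalIdeal A = Ideal.span {p} := by
    refine le_antisymm (fun b hb => ?_) ((Ideal.span_singleton_le_iff_mem _).2 hp)
    obtain ⟨d, hd⟩ := (hmem b).1 hb
    refine Ideal.mem_span_singleton.2 ((hc.dvd_mul_right).1 ⟨d, mul_left_cancel₀ hf ?_⟩)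
    linear_combination p * hd - b * hpc
  have hprincipal : (maximalIdeal A).IsPrincipal := ⟨p, hspan⟩
  exact ((IsDiscreteValuationRing.TFAE A (mt isField_iff_maximalIdeal_eq.1 hfm0)).out 0 4).2
    hprincipal

theorem isDiscreteValuationRing_localization_of_mem_associatedPrimes {S : Type*} [CommRing S]
    [IsDomain S] [IsNoetherianRing S] [IsIntegrallyClosed S] {f : S} (hf : f ≠ 0) {q : Ideal S}
    [q.IsPrime] (hq : q ∈ associatedPrimes S (S ⧸ Ideal.span {f})) :
    IsDiscreteValuationRing (Localization.AtPrime q) := by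
  have hle := q.primeCompl_le_nonZeroDivisors
  have := isIntegrallyClosed_of_isLocalization (S := Localization.AtPrime q) _ hle
  exact isDiscreteValuationRing_of_maximalIdeal_mem_associatedPrimes
    (mt (map_eq_zero_iff _ (IsLocalization.injective _ hle)).1 hf)
    (maximalIdeal_mem_associatedPrimes_localization hq)

end AssociatedPrimes

section FlatLocalization

variable {S T : Type*} [CommRing S] [CommRing T] [Algebra S T]

theorem isRadical_map_maximalIdeal_of_isReduced_fiber (q : Ideal S) [q.IsPrime]
    [IsReduced (q.Fiber T)] : ((maximalIdeal (Localization.AtPrime q)).map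
      (algebraMap _ (Localization.AtPrime q ⊗[S] T))).IsRadical := by
  let A := Localization.AtPrime q
  let e₁ : (A ⊗[S] T ⧸ (maximalIdeal A).map (algebraMap A (A ⊗[S] T))) ≃+*
        q.ResidueField ⊗[A] (A ⊗[S] T) :=
    (Algebra.TensorProduct.quotIdealMapEquivQuotTensor (A ⊗[S] T) (maximalIdeal A)).toRingEquiv
  let e₂ : q.ResidueField ⊗[A] (A ⊗[S] T) ≃+* q.Fiber T :=
    (Algebra.TensorProduct.cancelBaseChange S A A q.ResidueField T).toRingEquiv
  rw [Ideal.isRadical_iff_quotient_reduced]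
  exact isReduced_of_injective (e₁.trans e₂) (e₁.trans e₂).injective

theorem exists_smul_mem_smul_top_of_tmul_eq_smul {M : Type*} [AddCommGroup M] [Module S M]
    (q : Ideal S) [q.IsPrime] {f : S} {m : M} {z : Localization.AtPrime q ⊗[S] M}
    (h : 1 ⊗ₜ m = f • z) : ∃ s ∉ q, s • m ∈ Ideal.span {f} • (⊤ : Submodule S M) := by
  let π := (Ideal.span {f} • (⊤ : Submodule S M)).mkQ
  have hπ : f • π = 0 := LinearMap.ext fun x => (Submodule.Quotient.mk_eq_zero _).2
    (Submodule.smul_mem_smul (Ideal.mem_span_singleton_self f) trivial)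
  have hzero : (1 : Localization.AtPrime q) ⊗ₜ[S] π m = 0 := by
    rw [← LinearMap.lTensor_tmul, h, LinearMap.map_smul, ← LinearMap.smul_apply,
      ← LinearMap.lTensor_smul, hπ, LinearMap.lTensor_zero, LinearMap.zero_apply]
  obtain ⟨s, hs⟩ := (IsLocalizedModule.eq_zero_iff q.primeCompl
    (TensorProduct.mk S (Localization.AtPrime q) _ 1)).1 hzero
  exact ⟨s, s.2, (Submodule.Quotient.mk_eq_zero _).1 hs⟩

theorem algebraMap_mem_nonZeroDivisors_of_flat [Module.Flat S T] {s : S}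
    (hs : s ∈ nonZeroDivisors S) : algebraMap S T s ∈ nonZeroDivisors T := by
  refine mem_nonZeroDivisors_iff.2 ⟨fun t ht => ?_, fun t ht => ?_⟩ <;>
  exact (Module.Flat.isSMulRegular_of_nonZeroDivisors (M := T) hs).right_eq_zero_of_smul
    (by first | rwa [Algebra.smul_def] | rwa [Algebra.smul_def, mul_comm])

variable (S T) in
theorem algebraMapSubmonoid_nonZeroDivisors_le_of_flat [Module.Flat S T] :
    Algebra.algebraMapSubmonoid T (nonZeroDivisors S) ≤ nonZeroDivisors T := by
  rintro _ ⟨s, hs, rfl⟩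
  exact algebraMap_mem_nonZeroDivisors_of_flat hs

open Polynomial in
theorem eval_scaleRoots_map_eq_zero {A B : Type*} [CommRing A] [CommRing B] (φ : A →+* B)
    {p : A[X]} (hp : p.Monic) {f t : A} (h : (p.scaleRoots f).eval t = 0) :
    ((p.map φ).scaleRoots (φ f)).eval (φ t) = 0 := by
  cases subsingleton_or_nontrivial B
  · exact Subsingleton.elim _ _
  · rw [← map_scaleRoots p f φ (by simp [hp]), eval_map_apply, h, map_zero]

variable [IsNoetherianRing S] [IsDomain S] [IsIntegrallyClosed S] [Module.Flat S T]

open Polynomial in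
theorem dvd_of_eval_scaleRoots_algebraMap_eq_zero
    (hred : ∀ (q : Ideal S) [q.IsPrime], IsReduced (q.Fiber T)) {f : S} (hf : f ≠ 0) {p : T[X]}
    (hp : p.Monic) {t : T} (h : (p.scaleRoots (algebraMap S T f)).eval t = 0) :
    algebraMap S T f ∣ t := by
  suffices hmem : t ∈ Ideal.span {f} • (⊤ : Submodule S T) by
    obtain ⟨s, -, hs⟩ := by simpa only [Submodule.ideal_span_singleton_smul] using hmem
    exact ⟨s, by rw [← hs, ← Algebra.smul_def]; rfl⟩
  refine mem_smul_top_of_forall_mem_associatedPrimes _ fun q hq => ?_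
  have := hq.1
  have := hred q
  let A := Localization.AtPrime q
  have : IsDiscreteValuationRing A :=
    isDiscreteValuationRing_localization_of_mem_associatedPrimes hf hq
  obtain ⟨ϖ, hϖ⟩ := IsDiscreteValuationRing.exists_irreducible A
  obtain ⟨k, u, hu⟩ := IsDiscreteValuationRing.eq_unit_mul_pow_irreducible
    (mt (map_eq_zero_iff _ (IsLocalization.injective A q.primeCompl_le_nonZeroDivisors)).1 hf) hϖ
  suffices hdvd : algebraMap A (A ⊗[S] T) (ϖ ^ k) ∣ 1 ⊗ₜ t by
    have hfdvd : algebraMap S (A ⊗[S] T) f ∣ 1 ⊗ₜ t := by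
      rwa [IsScalarTower.algebraMap_apply S A, hu, map_mul,
        (u.isUnit.map (algebraMap A (A ⊗[S] T))).mul_left_dvd]
    obtain ⟨z, hz⟩ := hfdvd
    exact exists_smul_mem_smul_top_of_tmul_eq_smul q (hz.trans (Algebra.smul_def f z).symm)
  have hrad : (Ideal.span {algebraMap A (A ⊗[S] T) ϖ}).IsRadical := by
    rw [← Set.image_singleton, ← Ideal.map_span, ← hϖ.maximalIdeal_eq]
    exact isRadical_map_maximalIdeal_of_isReduced_fiber q
  have hreg : algebraMap A (A ⊗[S] T) ϖ ∈ nonZeroDivisors (A ⊗[S] T) :=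
    algebraMap_mem_nonZeroDivisors_of_flat (mem_nonZeroDivisors_of_ne_zero hϖ.ne_zero)
  let φ : T →+* A ⊗[S] T := (Algebra.TensorProduct.includeRight : T →ₐ[S] A ⊗[S] T)
  have hφf : φ (algebraMap S T f) = algebraMap A (A ⊗[S] T) u * algebraMap A (A ⊗[S] T) ϖ ^ k := by
    rw [← map_pow, ← map_mul, ← hu, ← IsScalarTower.algebraMap_apply]
    exact (Algebra.TensorProduct.includeRight : T →ₐ[S] A ⊗[S] T).commutes f
  have hφ := eval_scaleRoots_map_eq_zero φ hp h
  rw [hφf, scaleRoots_mul] at hφ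
  rw [map_pow]
  exact pow_dvd_of_eval_scaleRoots_eq_zero hreg hrad
    ((monic_scaleRoots_iff _).2 (hp.map φ)) hφ

end FlatLocalization

section NormalFibers

theorem isIdempotentElem_annihilator_span_singleton {W : Type*} [CommRing W]
    (hW : ∀ (P : Ideal W) [P.IsMaximal], IsDomain (Localization.AtPrime P)) (x : W) :
    IsIdempotentElem (Ideal.span {x}).annihilator := by
  refine Ideal.eq_of_localization_maximal fun P hP => ?_
  have := hW P
  let φ := algebraMap W (Localization.AtPrime P)
  by_cases hx : φ x = 0
  · obtain ⟨s, hs⟩ := (IsLocalization.map_eq_zero_iff P.primeCompl _ _).1 hx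
    have htop : (Ideal.span {x}).annihilator.map φ = ⊤ :=
      Ideal.eq_top_of_isUnit_mem _ (Ideal.mem_map_of_mem φ
        (Submodule.mem_annihilator_span_singleton _ _ |>.2 hs)) (IsLocalization.map_units _ s)
    rw [Ideal.map_mul, htop, Ideal.top_mul]
  · have hbot : (Ideal.span {x}).annihilator.map φ = ⊥ := by
      refine (Ideal.map_eq_bot_iff_le_ker φ).2 fun a ha => ?_
      have hax : a * x = 0 := (Submodule.mem_annihilator_span_singleton _ _).1 ha
      exact (mul_eq_zero.1 (by rw [← map_mul, hax, map_zero])).resolve_right hx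
    rw [Ideal.map_mul, hbot, Ideal.bot_mul]

theorem exists_isIdempotentElem_of_mul_eq_zero {W : Type*} [CommRing W] [IsNoetherianRing W]
    (hW : ∀ (P : Ideal W) [P.IsMaximal], IsDomain (Localization.AtPrime P)) {x y : W}
    (hxy : x * y = 0) : ∃ i : W, IsIdempotentElem i ∧ i * x = 0 ∧ i * y = y := by
  obtain ⟨i, hi, hIi⟩ := (Ideal.isIdempotentElem_iff_of_fg _ (IsNoetherian.noetherian _)).1
    (isIdempotentElem_annihilator_span_singleton hW x)
  have hmem (a : W) : a ∈ Ideal.span {i} ↔ a * x = 0 := by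
    rw [← Ideal.submodule_span_eq, ← hIi]
    exact Submodule.mem_annihilator_span_singleton x a
  obtain ⟨c, rfl⟩ := Ideal.mem_span_singleton.1 ((hmem y).2 (by rw [mul_comm, hxy]))
  exact ⟨i, hi, (hmem i).1 (Ideal.mem_span_singleton_self i), by rw [← mul_assoc, hi.eq]⟩

variable {S : Type*} {T : Type*} [CommRing S] [IsDomain S] [IsNoetherianRing S]
  [IsIntegrallyClosed S] [CommRing T] [Algebra S T] [Module.Flat S T] (W : Type*) [CommRing W]
  [Algebra T W] [IsLocalization (Algebra.algebraMapSubmonoid T (nonZeroDivisors S)) W]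

theorem exists_eq_algebraMap_of_isIntegral_of_isReduced_fiber
    (hred : ∀ (q : Ideal S) [q.IsPrime], IsReduced (q.Fiber T)) {y : W} (hy : IsIntegral T y) :
    ∃ t : T, algebraMap T W t = y := by
  have hle := algebraMapSubmonoid_nonZeroDivisors_le_of_flat S T
  obtain ⟨⟨t, _, f, hf, rfl⟩, hft⟩ :=
    IsLocalization.surj (Algebra.algebraMapSubmonoid T (nonZeroDivisors S)) y
  obtain ⟨p, hp, hpy⟩ := hy
  have hpt : (p.scaleRoots (algebraMap S T f)).eval t = 0 := by
    refine IsLocalization.injective W hle ?_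
    rw [map_zero, ← Polynomial.eval₂_at_apply, ← hft, mul_comm, Polynomial.scaleRoots_eval₂_mul,
      hpy, mul_zero]
  obtain ⟨z, rfl⟩ := dvd_of_eval_scaleRoots_algebraMap_eq_zero hred (nonZeroDivisors.ne_zero hf)
    hp hpt
  refine ⟨z, (IsLocalization.map_units W (⟨_, f, hf, rfl⟩ : Algebra.algebraMapSubmonoid T
    (nonZeroDivisors S))).mul_left_cancel ?_⟩
  rw [← map_mul, ← hft, mul_comm]

theorem exists_isIdempotentElem_of_mul_eq_zero_of_isRegularRing
    (hred : ∀ (q : Ideal S) [q.IsPrime], IsReduced (q.Fiber T)) [IsRegularRing W] {x y : T}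
    (hxy : x * y = 0) : ∃ i : T, IsIdempotentElem i ∧ i * x = 0 ∧ i * y = y := by
  have hinj : Function.Injective (algebraMap T W) :=
    IsLocalization.injective W (algebraMapSubmonoid_nonZeroDivisors_le_of_flat S T)
  obtain ⟨i, hi, hix, hiy⟩ := exists_isIdempotentElem_of_mul_eq_zero (W := W)
    (fun P _ => isDomain_of_isRegularLocalRing _) (x := algebraMap T W x) (y := algebraMap T W y)
    (by rw [← map_mul, hxy, map_zero])
  obtain ⟨j, rfl⟩ := exists_eq_algebraMap_of_isIntegral_of_isReduced_fiber W hred (y := i)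
    ⟨.X ^ 2 - .X, by monicity!, by simp [pow_two, hi.eq]⟩
  refine ⟨j, hinj (by rw [map_mul]; exact hi), hinj ?_, hinj ?_⟩
  · rw [map_mul, hix, map_zero]
  · rw [map_mul, hiy]

theorem isDomain_of_isRegularRing_localization
    (hred : ∀ (q : Ideal S) [q.IsPrime], IsReduced (q.Fiber T)) [IsRegularRing W]
    [IsLocalRing T] : IsDomain T := by
  have : NoZeroDivisors T := ⟨fun {x y} hxy => by
    obtain ⟨i, -, hix, hiy⟩ := exists_isIdempotentElem_of_mul_eq_zero_of_isRegularRing W hred hxy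
    rcases IsLocalRing.isUnit_or_isUnit_one_sub_self i with hu | hu
    · exact Or.inl (hu.mul_right_eq_zero.1 hix)
    · exact Or.inr (hu.mul_right_eq_zero.1 (by rw [sub_mul, one_mul, hiy, sub_self]))⟩
  exact NoZeroDivisors.to_isDomain T

theorem isIntegrallyClosed_of_isRegularRing_localization
    (hred : ∀ (q : Ideal S) [q.IsPrime], IsReduced (q.Fiber T)) [IsRegularRing W] [IsDomain T] :
    IsIntegrallyClosed T := by
  let M := Algebra.algebraMapSubmonoid T (nonZeroDivisors S)
  have hle : M ≤ nonZeroDivisors T := algebraMapSubmonoid_nonZeroDivisors_le_of_flat S T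
  have : IsDomain W := IsLocalization.isDomain_of_le_nonZeroDivisors W hle
  have : IsIntegrallyClosed W := isIntegrallyClosed_of_isRegularRing W
  let L := FractionRing T
  let _ : Algebra W L := (IsLocalization.lift (M := M) (g := algebraMap T L)
    fun y => IsLocalization.map_units L (⟨y, hle y.2⟩ : nonZeroDivisors T)).toAlgebra
  have : IsScalarTower T W L := IsScalarTower.of_algebraMap_eq fun y => by
    rw [RingHom.algebraMap_toAlgebra, IsLocalization.lift_eq]
  have : IsFractionRing W L := IsFractionRing.isFractionRing_of_isDomain_of_isLocalization M _ _
  refine (isIntegrallyClosed_iff L).2 fun {z} hz => ?_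
  obtain ⟨w, rfl⟩ := IsIntegrallyClosed.algebraMap_eq_of_integral (hz.tower_top (A := W))
  obtain ⟨t, rfl⟩ := exists_eq_algebraMap_of_isIntegral_of_isReduced_fiber W hred
    ((isIntegral_algHom_iff (IsScalarTower.toAlgHom T W L) (IsFractionRing.injective W L)).1 hz)
  exact ⟨t, IsScalarTower.algebraMap_apply T W L t⟩

end NormalFibers

section FormalFibers

variable {R : Type u} [CommRing R] [IsLocalRing R]

theorem HasGeometricallyRegularFormalFibers.isRegularRing_tensorProduct
    (h : HasGeometricallyRegularFormalFibers R) (p : Ideal R) [p.IsPrime] (L : Type v) [Field L]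
    [Algebra p.ResidueField L] [Module.Finite p.ResidueField L] [Algebra R L]
    [IsScalarTower R p.ResidueField L] : IsRegularRing (L ⊗[R] LocalCompletion R) := by
  have : Small.{u} L := Module.Finite.small p.ResidueField L
  let e : Shrink.{u} L ≃ₐ[p.ResidueField] L := Shrink.algEquiv p.ResidueField L
  have : Module.Finite p.ResidueField (Shrink.{u} L) := Module.Finite.equiv e.symm.toLinearEquiv
  have hreg := h p (Shrink.{u} L)
  let e1 : Shrink.{u} L ⊗[p.ResidueField] (p.Fiber (LocalCompletion R)) ≃+*
      L ⊗[p.ResidueField] (p.Fiber (LocalCompletion R)) :=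
    (Algebra.TensorProduct.congr e AlgEquiv.refl).toRingEquiv
  let e2 : L ⊗[p.ResidueField] (p.Fiber (LocalCompletion R)) ≃+* L ⊗[R] LocalCompletion R :=
    (Algebra.TensorProduct.cancelBaseChange R p.ResidueField p.ResidueField L
      (LocalCompletion R)).toRingEquiv
  have := IsRegularRing.of_ringEquiv (R := Shrink.{u} L ⊗[p.ResidueField]
    (p.Fiber (LocalCompletion R))) (R' := L ⊗[p.ResidueField] (p.Fiber (LocalCompletion R))) e1
  exact IsRegularRing.of_ringEquiv (R := L ⊗[p.ResidueField] (p.Fiber (LocalCompletion R))) e2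

theorem HasGeometricallyRegularFormalFibers.isRegularRing_fractionField_tensorProduct
    [IsDomain R] (h : HasGeometricallyRegularFormalFibers R)
    (K : Type v) [Field K] [Algebra R K] [IsFractionRing R K]
    (K' : Type w) [Field K'] [Algebra K K'] [FiniteDimensional K K']
    [Algebra R K'] [IsScalarTower R K K'] : IsRegularRing (K' ⊗[R] LocalCompletion R) := by
  let e : (⊥ : Ideal R).ResidueField ≃ₐ[R] K :=
    IsLocalization.algEquiv (nonZeroDivisors R) (⊥ : Ideal R).ResidueField K
  let _ : Algebra (⊥ : Ideal R).ResidueField K := e.toRingHom.toAlgebra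
  let _ : Algebra (⊥ : Ideal R).ResidueField K' :=
    ((algebraMap K K').comp e.toRingHom).toAlgebra
  have : IsScalarTower (⊥ : Ideal R).ResidueField K K' :=
    IsScalarTower.of_algebraMap_eq fun _ => rfl
  have : IsScalarTower R (⊥ : Ideal R).ResidueField K' := IsScalarTower.of_algebraMap_eq fun x => by
    change _ = algebraMap K K' (e (algebraMap R _ x))
    rw [AlgEquiv.commutes, ← IsScalarTower.algebraMap_apply]
  have : Module.Finite (⊥ : Ideal R).ResidueField K :=
    Module.Finite.of_surjective (Algebra.linearMap _ K) e.surjective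
  have : Module.Finite (⊥ : Ideal R).ResidueField K' := Module.Finite.trans K K'
  exact h.isRegularRing_tensorProduct ⊥ K'

theorem HasGeometricallyRegularFormalFibers.isRegularRing_tensorProduct_fractionRing [IsDomain R]
    (h : HasGeometricallyRegularFormalFibers R) :
    IsRegularRing (LocalCompletion R ⊗[R] FractionRing R) := by
  have := h.isRegularRing_fractionField_tensorProduct (FractionRing R) (FractionRing R)
  exact IsRegularRing.of_ringEquiv (R := FractionRing R ⊗[R] LocalCompletion R)
    (Algebra.TensorProduct.comm R _ _).toRingEquiv

theorem HasGeometricallyRegularFormalFibers.isReduced_fiber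
    (h : HasGeometricallyRegularFormalFibers R) (q : Ideal R) [q.IsPrime] :
    IsReduced (q.Fiber (LocalCompletion R)) := by
  have := h.isRegularRing_tensorProduct q q.ResidueField
  exact isReduced_of_isRegularRing (q.Fiber (LocalCompletion R))

theorem HasGeometricallyRegularFormalFibers.isReduced_fiber_tensorProduct
    (h : HasGeometricallyRegularFormalFibers R) (S : Type v) [CommRing S] [Algebra R S]
    [Module.Finite R S] (q : Ideal S) [q.IsPrime] :
    IsReduced (q.Fiber (S ⊗[R] LocalCompletion R)) := by
  let p : Ideal R := q.under R
  let := Localization.AtPrime.algebraOfLiesOver p q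
  have : IsScalarTower R p.ResidueField q.ResidueField := inferInstance
  have : Module.Finite p.ResidueField q.ResidueField := inferInstance
  have := h.isRegularRing_tensorProduct p q.ResidueField
  let e : q.Fiber (S ⊗[R] LocalCompletion R) ≃+* q.ResidueField ⊗[R] LocalCompletion R :=
    (Algebra.TensorProduct.cancelBaseChange R S S q.ResidueField
      (LocalCompletion R)).toRingEquiv
  have hr := isReduced_of_isRegularRing (q.ResidueField ⊗[R] LocalCompletion R)
  exact isReduced_of_injective e e.injective

variable [IsNoetherianRing R] [IsDomain R]

theorem HasGeometricallyRegularFormalFibers.isDomain_localCompletion [IsIntegrallyClosed R]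
    (h : HasGeometricallyRegularFormalFibers R) : IsDomain (LocalCompletion R) := by
  have := h.isRegularRing_tensorProduct_fractionRing
  exact isDomain_of_isRegularRing_localization (S := R) (T := LocalCompletion R)
    (LocalCompletion R ⊗[R] FractionRing R) fun q _ => h.isReduced_fiber q

theorem HasGeometricallyRegularFormalFibers.isIntegrallyClosed_localCompletion
    [IsIntegrallyClosed R]
    (h : HasGeometricallyRegularFormalFibers R) : IsIntegrallyClosed (LocalCompletion R) := by
  have := h.isDomain_localCompletion
  have := h.isRegularRing_tensorProduct_fractionRing
  exact isIntegrallyClosed_of_isRegularRing_localization (S := R) (T := LocalCompletion R)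
    (LocalCompletion R ⊗[R] FractionRing R) fun q _ => h.isReduced_fiber q

theorem HasGeometricallyRegularFormalFibers.exists_isIdempotentElem_of_mul_eq_zero_tensorProduct
    (h : HasGeometricallyRegularFormalFibers R)
    (K : Type v) [Field K] [Algebra R K] [IsFractionRing R K]
    (K' : Type w) [Field K'] [Algebra K K'] [FiniteDimensional K K']
    [Algebra R K'] [IsScalarTower R K K'] (S : Type*) [CommRing S] [IsDomain S]
    [IsIntegrallyClosed S] [Algebra R S] [Module.Finite R S] [Algebra S K'] [IsFractionRing S K']
    [IsScalarTower R S K'] {x y : S ⊗[R] LocalCompletion R} (hxy : x * y = 0) :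
    ∃ i, IsIdempotentElem i ∧ i * x = 0 ∧ i * y = y := by
  have hS : IsNoetherianRing S := IsNoetherianRing.of_finite R S
  have hreg := h.isRegularRing_fractionField_tensorProduct K K'
  let _ : Algebra (S ⊗[R] LocalCompletion R) (K' ⊗[R] LocalCompletion R) :=
    (Algebra.TensorProduct.map (IsScalarTower.toAlgHom R S K')
      (AlgHom.id R (LocalCompletion R))).toRingHom.toAlgebra
  have : IsScalarTower S (S ⊗[R] LocalCompletion R) (K' ⊗[R] LocalCompletion R) :=
    IsScalarTower.of_algebraMap_eq (R := S) (S := S ⊗[R] LocalCompletion R)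
      (A := K' ⊗[R] LocalCompletion R) fun s => by
      rw [RingHom.algebraMap_toAlgebra]
      simp [Algebra.TensorProduct.algebraMap_apply]
  have : IsLocalization (Algebra.algebraMapSubmonoid (S ⊗[R] LocalCompletion R)
      (nonZeroDivisors S)) (K' ⊗[R] LocalCompletion R) :=
    IsLocalization.tensorProduct_tensorProduct R (LocalCompletion R) (nonZeroDivisors S) K' (by
      ext x
      rw [RingHom.algebraMap_toAlgebra]
      simp)
  exact exists_isIdempotentElem_of_mul_eq_zero_of_isRegularRing (S := S) (K' ⊗[R] LocalCompletion R)
    (fun q _ => h.isReduced_fiber_tensorProduct S q) hxy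

end FormalFibers

/-! ### Finiteness of the integral closure -/

section DiscreteValuationRing

theorem isPrecomplete_fin_fun {P : Type*} [CommRing P] (I : Ideal P) [IsPrecomplete I P] (r : ℕ) :
    IsPrecomplete I (Fin r → P) := by
  have hmem (n : ℕ) (x : Fin r → P) :
      x ∈ (I ^ n • ⊤ : Submodule P (Fin r → P)) ↔ ∀ i, x i ∈ (I ^ n • ⊤ : Submodule P P) := by
    refine ⟨fun hx i => ?_, fun hx => ?_⟩
    · have hi := Submodule.mem_map_of_mem (f := LinearMap.proj (φ := fun _ => P) i) hx
      rw [Submodule.map_smul''] at hi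
      exact Submodule.smul_mono le_rfl le_top hi
    · classical
      rw [pi_eq_sum_univ' x]
      exact Submodule.sum_mem _ fun i _ => Submodule.smul_mem_smul (by simpa using hx i) trivial
  refine ⟨fun f hf => ?_⟩
  have hlim (i : Fin r) : ∃ L : P, ∀ n, f n i ≡ L [SMOD (I ^ n • ⊤ : Submodule P P)] :=
    IsPrecomplete.prec inferInstance fun hmn =>
      SModEq.sub_mem.2 ((hmem _ _).1 (SModEq.sub_mem.1 (hf hmn)) i)
  choose L hL using hlim
  exact ⟨L, fun n => SModEq.sub_mem.2 ((hmem _ _).2 fun i => SModEq.sub_mem.1 (hL i n))⟩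

theorem moduleFinite_of_isPrecomplete {P N : Type*} [CommRing P] (I : Ideal P) [IsPrecomplete I P]
    [AddCommGroup N] [Module P N] [IsHausdorff I N] {V : Submodule P N} (hV : V.FG)
    (h : V ⊔ I • ⊤ = ⊤) : Module.Finite P N := by
  obtain ⟨r, s, rfl⟩ := Submodule.fg_iff_exists_fin_generating_family.1 hV
  have := isPrecomplete_fin_fun I r
  let f : (Fin r → P) →ₗ[P] N := Fintype.linearCombination P s
  refine Module.Finite.of_surjective f (surjective_of_mkQ_comp_surjective (I := I) ?_)
  rintro ⟨x⟩
  obtain ⟨_, ⟨c, rfl⟩, b, hb, rfl⟩ :=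
    Submodule.mem_sup.1 (show x ∈ LinearMap.range f ⊔ I • ⊤ by
      rw [Fintype.range_linearCombination, h]; trivial)
  exact ⟨c, (Submodule.Quotient.eq _).2 (by simpa [f] using hb)⟩

theorem finite_residueField_tensorProduct_of_flat {A M : Type*} [CommRing A] [IsLocalRing A]
    [AddCommGroup M] [Module A M] [Module.Flat A M] (h : Module.rank A M < Cardinal.aleph0) :
    Module.Finite (ResidueField A) (ResidueField A ⊗[A] M) := by
  obtain ⟨n, hn⟩ := Cardinal.lt_aleph0.1 h
  refine Module.rank_lt_aleph0_iff.1
    ((rank_le (n := n) fun s hs => ?_).trans_lt Cardinal.natCast_lt_aleph0)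
  obtain ⟨g, hg⟩ := (TensorProduct.mk_surjective A M (ResidueField A)
    IsLocalRing.residue_surjective).hasRightInverse
  have hli : LinearIndependent A (fun i : s => g i) :=
    Module.IsLocalRing.linearIndependent_of_flat _ (by simpa [Function.comp_def, hg _] using hs)
  have := hli.cardinal_lift_le_rank
  simpa [hn] using this

theorem exists_fg_sup_smul_top_eq_top {A M : Type*} [CommRing A] [IsLocalRing A]
    [AddCommGroup M] [Module A M] [Module.Flat A M] (h : Module.rank A M < Cardinal.aleph0) :
    ∃ V : Submodule A M, V.FG ∧ V ⊔ maximalIdeal A • ⊤ = ⊤ := by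
  let μ := TensorProduct.mk A (ResidueField A) M 1
  have hμ : Function.Surjective μ :=
    TensorProduct.mk_surjective A M (ResidueField A) IsLocalRing.residue_surjective
  have := finite_residueField_tensorProduct_of_flat h
  have : Module.Finite A (ResidueField A ⊗[A] M) := Module.Finite.trans (ResidueField A) _
  obtain ⟨r, s, hs⟩ := Module.Finite.exists_fin (R := A) (M := ResidueField A ⊗[A] M)
  choose v hv using fun i => hμ (s i)
  refine ⟨Submodule.span A (Set.range v), Submodule.fg_span (Set.finite_range v), ?_⟩
  rw [← LinearMap.ker_tensorProductMk, ← Submodule.comap_map_eq, Submodule.map_span,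
    ← Set.range_comp]
  change (Submodule.span A (Set.range fun i => μ (v i))).comap μ = ⊤
  simp_rw [hv, hs, Submodule.comap_top]

theorem baseChange_sup_map_smul_top_eq_top {A M : Type*} (P : Type*) [CommRing A] [CommRing P]
    [Algebra A P] [AddCommGroup M] [Module A M] {I : Ideal A} {V : Submodule A M}
    (h : V ⊔ I • ⊤ = ⊤) : V.baseChange P ⊔ I.map (algebraMap A P) • ⊤ = ⊤ := by
  have hI (a : P) (m : M) (hm : m ∈ (I • ⊤ : Submodule A M)) :
      a ⊗ₜ[A] m ∈ (I.map (algebraMap A P) • ⊤ : Submodule P (P ⊗[A] M)) := by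
    induction hm using Submodule.smul_induction_on' with
    | smul r hr m _ =>
      rw [TensorProduct.tmul_smul, ← algebraMap_smul P r]
      exact Submodule.smul_mem_smul (Ideal.mem_map_of_mem _ hr) trivial
    | add m _ m' _ ih ih' => rw [TensorProduct.tmul_add]; exact add_mem ih ih'
  refine eq_top_iff.2 fun x _ => ?_
  induction x with
  | zero => exact zero_mem _
  | add x y hx hy => exact add_mem (hx trivial) (hy trivial)
  | tmul a m =>
    obtain ⟨v, hv, i, hi, rfl⟩ := Submodule.mem_sup.1 (h ▸ Submodule.mem_top (x := m))
    rw [TensorProduct.tmul_add]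
    exact Submodule.add_mem_sup (Submodule.tmul_mem_baseChange_of_mem a hv) (hI a i hi)

theorem dvd_of_algebraMap_dvd_algebraMap {P D : Type*} [CommRing P] [IsDomain P]
    [IsIntegrallyClosed P] [CommRing D] [IsDomain D] [Algebra P D] [FaithfulSMul P D]
    [Algebra.IsIntegral P D] {c a : P} (h : algebraMap P D c ∣ algebraMap P D a) : c ∣ a := by
  obtain rfl | hc := eq_or_ne c 0
  · simpa using h
  obtain ⟨b, hb⟩ := h
  let E := FractionRing P
  let L := FractionRing D
  have : FaithfulSMul P L := FaithfulSMul.trans P D L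
  let _ : Algebra E L := FractionRing.liftAlgebra P L
  have hcE : algebraMap P E c ≠ 0 := by simpa using hc
  have hcL : algebraMap P L c ≠ 0 := by simpa using hc
  have hbL : algebraMap E L (algebraMap P E a / algebraMap P E c) = algebraMap D L b := by
    rw [map_div₀, ← IsScalarTower.algebraMap_apply, ← IsScalarTower.algebraMap_apply,
      div_eq_iff hcL, IsScalarTower.algebraMap_apply P D L, hb, map_mul, mul_comm,
      ← IsScalarTower.algebraMap_apply]
  have hint : IsIntegral P (algebraMap P E a / algebraMap P E c) := by
    rw [← isIntegral_algebraMap_iff (algebraMap E L).injective, hbL]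
    exact (Algebra.IsIntegral.isIntegral b).algebraMap
  obtain ⟨d, hd⟩ := IsIntegrallyClosed.algebraMap_eq_of_integral hint
  refine ⟨d, IsFractionRing.injective P E ?_⟩
  rw [map_mul, hd, mul_div_cancel₀ _ hcE]

theorem eq_zero_of_forall_pow_dvd {P D : Type*} [CommRing P] [IsDomain P]
    [IsIntegrallyClosed P] [CommRing D] [IsDomain D] [Algebra P D] [FaithfulSMul P D]
    [Algebra.IsIntegral P D] (π : P) [IsHausdorff (Ideal.span {π}) P] {w : D}
    (hw : ∀ n, algebraMap P D π ^ n ∣ w) : w = 0 := by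
  by_contra hw0
  obtain ⟨a, ha, hwa⟩ := (Algebra.IsIntegral.isIntegral (R := P) w).isAlgebraic.exists_nonzero_dvd
    (mem_nonZeroDivisors_of_ne_zero hw0)
  refine ha (IsHausdorff.haus (I := Ideal.span {π}) inferInstance a fun n => ?_)
  rw [SModEq.zero, smul_eq_mul, Ideal.mul_top, Ideal.span_singleton_pow, Ideal.mem_span_singleton]
  exact dvd_of_algebraMap_dvd_algebraMap (D := D) (by rw [map_pow]; exact (hw n).trans hwa)

theorem isHausdorff_of_isReduced_of_isIntegral {P W : Type*} [CommRing P] [IsDomain P]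
    [IsIntegrallyClosed P] [CommRing W] [IsReduced W] [Algebra P W] [Algebra.IsIntegral P W]
    [Module.IsTorsionFree P W] (π : P) [IsHausdorff (Ideal.span {π}) P] :
    IsHausdorff (Ideal.span {π}) W := by
  refine ⟨fun w hw => ?_⟩
  have hdvd (n : ℕ) : algebraMap P W π ^ n ∣ w := by
    have := hw n
    rw [SModEq.zero, Ideal.span_singleton_pow, Submodule.ideal_span_singleton_smul] at this
    obtain ⟨z, -, rfl⟩ := this
    exact ⟨z, by rw [← map_pow, ← Algebra.smul_def]; rfl⟩
  have hmin : ∀ Q ∈ minimalPrimes W, w ∈ Q := fun Q hQ => by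
    have := hQ.1.1
    have : FaithfulSMul P (W ⧸ Q) := by
      refine (faithfulSMul_iff_algebraMap_injective P (W ⧸ Q)).2 <|
        (injective_iff_map_eq_zero _).2 fun a ha => ?_
      by_contra ha0
      exact notMem_nonZeroDivisors_of_mem_mem_minimalPrimes (x := algebraMap P W a)
        (Ideal.Quotient.eq_zero_iff_mem.1 ha) hQ
        (mem_nonZeroDivisors_iff_right.2 fun z hz =>
          (smul_eq_zero_iff_right ha0).1 (by rwa [Algebra.smul_def, mul_comm]))
    rw [← Ideal.Quotient.eq_zero_iff_mem]
    refine eq_zero_of_forall_pow_dvd π fun n => ?_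
    have := map_dvd (Ideal.Quotient.mk Q) (hdvd n)
    rwa [map_pow] at this
  have : w ∈ nilradical W := by
    rw [nilradical, ← Ideal.sInf_minimalPrimes]
    exact Submodule.mem_sInf.2 hmin
  exact (nilradical_eq_zero W ▸ this : w ∈ (0 : Ideal W))

instance LocalCompletion.faithfullyFlat (R : Type u) [CommRing R] [IsLocalRing R]
    [IsNoetherianRing R] : Module.FaithfullyFlat R (LocalCompletion R) :=
  Module.FaithfullyFlat.of_flat_of_isLocalHom

theorem HasGeometricallyRegularFormalFibers.isReduced_tensorProduct_integralClosure
    {R : Type u} [CommRing R] [IsDomain R] [IsLocalRing R] [IsNoetherianRing R]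
    (h : HasGeometricallyRegularFormalFibers R)
    (K : Type v) [Field K] [Algebra R K] [IsFractionRing R K]
    (K' : Type w) [Field K'] [Algebra K K'] [FiniteDimensional K K']
    [Algebra R K'] [IsScalarTower R K K'] :
    IsReduced (LocalCompletion R ⊗[R] integralClosure R K') := by
  have := h.isRegularRing_fractionField_tensorProduct K K'
  have := isReduced_of_isRegularRing (K' ⊗[R] LocalCompletion R)
  let ψ : LocalCompletion R ⊗[R] integralClosure R K' →ₐ[R] K' ⊗[R] LocalCompletion R :=
    (Algebra.TensorProduct.comm R (LocalCompletion R) K').toAlgHom.comp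
      (Algebra.TensorProduct.map (AlgHom.id R _) (integralClosure R K').val)
  refine isReduced_of_injective ψ
    ((Algebra.TensorProduct.comm R (LocalCompletion R) K').injective.comp ?_)
  exact Module.Flat.lTensor_preserves_injective_linearMap
    (integralClosure R K').val.toLinearMap Subtype.val_injective

theorem HasGeometricallyRegularFormalFibers.finite_integralClosure_of_isDiscreteValuationRing
    {A : Type u} [CommRing A] [IsDomain A] [IsDiscreteValuationRing A]
    (h : HasGeometricallyRegularFormalFibers A)
    (K : Type v) [Field K] [Algebra A K] [IsFractionRing A K]
    (K' : Type w) [Field K'] [Algebra K K'] [FiniteDimensional K K']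
    [Algebra A K'] [IsScalarTower A K K'] : Module.Finite A (integralClosure A K') := by
  let P := LocalCompletion A
  have : FaithfulSMul A K' := FaithfulSMul.trans A K K'
  have hrank : Module.rank A (integralClosure A K') < Cardinal.aleph0 :=
    (Submodule.rank_le (integralClosure A K').toSubmodule).trans_lt <| by
      rw [← IsLocalization.rank_eq K (nonZeroDivisors A) le_rfl]
      exact Module.rank_lt_aleph0 K K'
  obtain ⟨V, ⟨s, rfl⟩, hV⟩ := exists_fg_sup_smul_top_eq_top hrank
  have : IsDomain P := h.isDomain_localCompletion
  have : IsIntegrallyClosed P := h.isIntegrallyClosed_localCompletion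
  have := h.isReduced_tensorProduct_integralClosure K K'
  obtain ⟨π, hπ⟩ := IsPrincipalIdealRing.principal (maximalIdeal A)
  have hP : maximalIdeal P = Ideal.span {algebraMap A P π} := by
    rw [AdicCompletion.maximalIdeal_eq_map, ← Set.image_singleton, ← Ideal.map_span]
    exact congrArg (Ideal.map (algebraMap A P)) hπ
  have : IsHausdorff (maximalIdeal P) (P ⊗[A] integralClosure A K') := by
    have : IsHausdorff (Ideal.span {algebraMap A P π}) P := hP ▸ inferInstance
    exact hP ▸ isHausdorff_of_isReduced_of_isIntegral (algebraMap A P π)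
  have : Module.Finite P (P ⊗[A] integralClosure A K') := by
    refine moduleFinite_of_isPrecomplete (maximalIdeal P) ?_
      (AdicCompletion.maximalIdeal_eq_map (R := A) ▸ baseChange_sup_map_smul_top_eq_top P hV)
    rw [Submodule.baseChange_span]
    exact Submodule.fg_span (s.finite_toSet.image _)
  exact Module.Finite.of_finite_tensorProduct_of_faithfullyFlat P

end DiscreteValuationRing

section FiniteIntegralClosure

theorem IsExcellentRing.exists_forall_isRegularLocalRing (R : Type u) [CommRing R]
    [IsExcellentRing R] (B : Type*) [CommRing B] [IsDomain B] [Algebra R B]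
    [Algebra.FiniteType R B] :
    ∃ b : B, b ≠ 0 ∧ ∀ (p : Ideal B) [p.IsPrime], b ∉ p →
      IsRegularLocalRing (Localization.AtPrime p) := by
  -- `isOpen_regularLocus` only speaks of algebras in the universe of `R`.
  obtain ⟨n, f, hf⟩ := Algebra.FiniteType.iff_quotient_mvPolynomial''.1 ‹Algebra.FiniteType R B›
  let Q := MvPolynomial (Fin n) R ⧸ RingHom.ker f
  let e : Q ≃ₐ[R] B := Ideal.quotientKerAlgEquivOfSurjective hf
  have : IsDomain Q := e.toMulEquiv.isDomain
  have : IsRegularLocalRing (Localization.AtPrime (⊥ : Ideal Q)) := by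
    have : IsFractionRing Q (Localization.AtPrime (⊥ : Ideal Q)) := by
      rw [IsFractionRing, ← Ideal.primeCompl_bot]
      infer_instance
    let _ := IsFractionRing.toField Q (K := Localization.AtPrime (⊥ : Ideal Q))
    infer_instance
  obtain ⟨_, ⟨q, rfl⟩, hq, hle⟩ :=
    PrimeSpectrum.isTopologicalBasis_basic_opens.exists_subset_of_mem_open
      (show (⟨⊥, Ideal.isPrime_bot⟩ : PrimeSpectrum Q) ∈ _ from this)
      (IsExcellentRing.isOpen_regularLocus (R := R) Q)
  refine ⟨e q, by simpa using hq, fun p hp hqp => ?_⟩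
  have : IsRegularLocalRing (Localization.AtPrime (p.comap e)) :=
    hle (show (⟨p.comap e, inferInstance⟩ : PrimeSpectrum Q) ∈ _ from hqp)
  exact .of_ringEquiv (R := Localization.AtPrime (p.comap e))
    (Localization.localRingEquiv (p.comap e) p e.toRingEquiv rfl)

theorem IsExcellentRing.exists_forall_pow_smul_mem_range (R : Type u) [CommRing R]
    [IsExcellentRing R] (B : Type*) [CommRing B] [IsDomain B] [Algebra R B]
    [Algebra.FiniteType R B] (L : Type*) [Field L] [Algebra B L] [IsFractionRing B L] :
    ∃ b : B, b ≠ 0 ∧ ∀ y : L, IsIntegral B y → ∃ n : ℕ, b ^ n • y ∈ (algebraMap B L).range := by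
  have : IsNoetherianRing B := Algebra.FiniteType.isNoetherianRing R B
  obtain ⟨b, hb, hreg⟩ := IsExcellentRing.exists_forall_isRegularLocalRing R B
  refine ⟨b, hb, fun y hy => ?_⟩
  have hle : Submonoid.powers b ≤ nonZeroDivisors B :=
    powers_le_nonZeroDivisors_of_noZeroDivisors hb
  let C := Localization.Away b
  let _ := IsLocalization.localizationAlgebraOfSubmonoidLe C L _ _ hle
  have := IsLocalization.localization_isScalarTower_of_submonoid_le C L _ _ hle
  have : IsDomain C := IsLocalization.isDomain_localization hle
  have : IsFractionRing C L :=
    IsFractionRing.isFractionRing_of_isDomain_of_isLocalization (Submonoid.powers b) C L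
  have : IsRegularRing C := isRegularRing_of_isLocalization_of_forall_disjoint
    (Submonoid.powers b) (fun p _ hp => hreg p fun hbp =>
      Set.disjoint_left.1 hp (Submonoid.mem_powers b) hbp) C
  have := isIntegrallyClosed_of_isRegularRing C
  obtain ⟨c, hc⟩ := IsIntegrallyClosed.algebraMap_eq_of_integral (hy.tower_top (A := C))
  obtain ⟨⟨x, ⟨_, n, rfl⟩⟩, hx⟩ := IsLocalization.surj (Submonoid.powers b) c
  refine ⟨n, x, ?_⟩
  rw [IsScalarTower.algebraMap_apply B C, ← hx, map_mul, hc, ← IsScalarTower.algebraMap_apply,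
    Algebra.smul_def, mul_comm]

theorem exists_ne_zero_forall_of_forall_exists {ι R : Type*} [CommRing R] [IsDomain R]
    {P : ι → R → Prop} (s : Finset ι) (hmul : ∀ i c d, P i c → P i (d * c))
    (h : ∀ i ∈ s, ∃ c ≠ 0, P i c) : ∃ c ≠ 0, ∀ i ∈ s, P i c := by
  classical
  choose! c hc0 hc using h
  refine ⟨∏ i ∈ s, c i, Finset.prod_ne_zero_iff.2 hc0, fun i hi => ?_⟩
  rw [← Finset.prod_erase_mul s c hi]
  exact hmul i _ _ (hc i hi)

theorem exists_ne_zero_forall_smul_mem_span_of_fg {R K L ι : Type*} [CommRing R] [IsDomain R]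
    [Field K] [Algebra R K] [IsFractionRing R K] [AddCommGroup L] [Module K L] [Module R L]
    [IsScalarTower R K L] (b : Module.Basis ι K L) {V : Submodule R L} (hV : V.FG) :
    ∃ c : R, c ≠ 0 ∧ ∀ x ∈ V, c • x ∈ Submodule.span R (Set.range b) := by
  obtain ⟨s, rfl⟩ := hV
  obtain ⟨c, hc0, hc⟩ := exists_ne_zero_forall_of_forall_exists
    (P := fun x (c : R) => c • x ∈ Submodule.span R (Set.range b)) s
    (fun x c d hx => by rw [mul_smul]; exact Submodule.smul_mem _ d hx) fun x _ => by
      obtain ⟨⟨c, hc⟩, hx⟩ := multiple_mem_span_of_mem_localization_span (nonZeroDivisors R) K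
        (Set.range b) x (b.span_eq ▸ Submodule.mem_top)
      exact ⟨c, nonZeroDivisors.ne_zero hc, hx⟩
  refine ⟨c, hc0, fun x hx => ?_⟩
  have hle : Submodule.span R (s : Set L) ≤
      (Submodule.span R (Set.range b)).comap (LinearMap.lsmul R L c) := Submodule.span_le.2 hc
  exact hle hx

theorem isFractionRing_adjoin_range_basis (R : Type*) {K L ι : Type*} [CommRing R] [IsDomain R]
    [Field K] [Algebra R K] [IsFractionRing R K] [Field L] [Algebra K L] [Algebra R L]
    [IsScalarTower R K L] (b : Module.Basis ι K L) :
    IsFractionRing (Algebra.adjoin R (Set.range b)) L := by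
  have : FaithfulSMul R L := FaithfulSMul.trans R K L
  refine IsFractionRing.of_field _ _ fun z => ?_
  obtain ⟨c, hc0, hc⟩ := exists_ne_zero_forall_smul_mem_span_of_fg (R := R) b
    (Submodule.fg_span_singleton z)
  have hcz := Algebra.span_le_adjoin R _ (hc z (Submodule.mem_span_singleton_self z))
  refine ⟨⟨c • z, hcz⟩, algebraMap R _ c, ?_⟩
  rw [← IsScalarTower.algebraMap_apply, eq_div_iff (by simpa using hc0), mul_comm,
    ← Algebra.smul_def]
  rfl

theorem IsExcellentRing.exists_forall_pow_smul_mem_span {R : Type u} {K L ι : Type*} [CommRing R]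
    [IsDomain R] [IsExcellentRing R] [Field K] [Algebra R K] [IsFractionRing R K] [Field L]
    [Algebra K L] [Algebra R L] [IsScalarTower R K L] [Finite ι] (b : Module.Basis ι K L)
    (hb : ∀ i, IsIntegral R (b i)) :
    ∃ g : R, g ≠ 0 ∧ ∀ y : L, IsIntegral R y →
      ∃ n : ℕ, g ^ n • y ∈ Submodule.span R (Set.range b) := by
  let B := Algebra.adjoin R (Set.range b)
  have hB : B.toSubmodule.FG := fg_adjoin_of_finite (Set.finite_range b) (Set.forall_mem_range.2 hb)
  have : Module.Finite R B := Module.Finite.iff_fg.2 hB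
  have : IsFractionRing B L := isFractionRing_adjoin_range_basis R b
  obtain ⟨β, hβ0, hβ⟩ := IsExcellentRing.exists_forall_pow_smul_mem_range R B L
  have hβR : IsAlgebraic R β := (Algebra.IsIntegral.isIntegral β).isAlgebraic
  obtain ⟨g, hg0, δ, hδ⟩ := hβR.exists_nonzero_dvd (mem_nonZeroDivisors_of_ne_zero hβ0)
  obtain ⟨c, hc0, hc⟩ := exists_ne_zero_forall_smul_mem_span_of_fg (R := R) b hB
  refine ⟨c * g, mul_ne_zero hc0 hg0, fun y hy => ?_⟩
  obtain ⟨n, x, hx⟩ := hβ y hy.tower_top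
  have hmem : g ^ (n + 1) • y ∈ B := by
    have : g ^ n • y = ↑(δ ^ n * x) := by
      rw [← algebraMap_smul B, map_pow, hδ, mul_comm, mul_pow, mul_smul, ← hx]
      rfl
    rw [pow_succ', mul_smul, this]
    exact B.smul_mem (SetLike.coe_mem _) g
  refine ⟨n + 1, ?_⟩
  rw [mul_pow, pow_succ c, mul_assoc, mul_smul, mul_smul]
  exact Submodule.smul_mem _ _ (hc _ hmem)

theorem exists_ne_zero_forall_smul_mem_span_of_finite_localization {R A K L ι : Type*} [CommRing R]
    [IsDomain R] [CommRing A] [IsDomain A] [Algebra R A] {M : Submonoid R} [IsLocalization M A]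
    [Field K] [Algebra A K] [IsFractionRing A K] [Field L] [Algebra K L] [Algebra R L] [Algebra A L]
    [IsScalarTower A K L] [IsScalarTower R A L] [Module.Finite A (integralClosure A L)]
    (b : Module.Basis ι K L) :
    ∃ c : R, c ≠ 0 ∧ ∀ y : L, IsIntegral R y →
      ∃ s ∈ M, s • c • y ∈ Submodule.span R (Set.range b) := by
  obtain ⟨a, ha0, ha⟩ := exists_ne_zero_forall_smul_mem_span_of_fg b
    (V := (integralClosure A L).toSubmodule) (Module.Finite.iff_fg.1 inferInstance)
  obtain ⟨⟨c, s⟩, hcs⟩ := IsLocalization.surj M a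
  refine ⟨c, ?_, fun y hy => ?_⟩
  · rintro rfl
    rw [map_zero] at hcs
    exact ha0 ((IsLocalization.map_units A s).mul_left_eq_zero.1 hcs)
  · have hcy : c • y ∈ Submodule.span A (Set.range b) := by
      rw [← algebraMap_smul A, ← hcs, mul_comm, mul_smul]
      exact Submodule.smul_mem _ _ (ha y hy.tower_top)
    obtain ⟨⟨t, ht⟩, hty⟩ := multiple_mem_span_of_mem_localization_span M A _ _ hcy
    exact ⟨t, ht, hty⟩

theorem mem_of_pow_smul_mem_of_forall_mem_associatedPrimes {R L : Type*} [CommRing R]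
    [IsNoetherianRing R] [IsDomain R] [AddCommGroup L] [Module R L] [Module.IsTorsionFree R L]
    {F : Submodule R L} [Module.Flat R F] {g : R} (hg : g ≠ 0) {z : L} (n : ℕ)
    (hz : g ^ n • z ∈ F)
    (h : ∀ q ∈ associatedPrimes R (R ⧸ Ideal.span {g}), ∃ s ∉ q, s • z ∈ F) : z ∈ F := by
  induction n with
  | zero => simpa using hz
  | succ n ih =>
    refine ih ?_
    have hmem : (⟨_, hz⟩ : F) ∈ Ideal.span {g} • (⊤ : Submodule R F) := by
      refine mem_smul_top_of_forall_mem_associatedPrimes _ fun q hq => ?_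
      obtain ⟨s, hsq, hs⟩ := h q hq
      rw [Submodule.ideal_span_singleton_smul]
      refine ⟨s, hsq, ⟨_, F.smul_mem (g ^ n) hs⟩, trivial, Subtype.ext ?_⟩
      change g • g ^ n • s • z = s • g ^ (n + 1) • z
      rw [smul_smul, ← pow_succ', smul_comm]
    rw [Submodule.ideal_span_singleton_smul] at hmem
    obtain ⟨f, -, hf⟩ := hmem
    have hgz : g • (f : L) = g • g ^ n • z := by
      rw [smul_smul, ← pow_succ']
      exact congrArg Subtype.val hf
    exact smul_right_injective L hg hgz ▸ f.2

theorem IsExcellentRing.exists_forall_smul_mem_span_of_mem_associatedPrimes {R : Type u}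
    [CommRing R] [IsDomain R] [IsIntegrallyClosed R] [IsExcellentRing R]
    {K : Type v} [Field K] [Algebra R K] [IsFractionRing R K]
    {K' : Type w} [Field K'] [Algebra K K'] [FiniteDimensional K K']
    [Algebra R K'] [IsScalarTower R K K'] {ι : Type*} (b : Module.Basis ι K K')
    {g : R} (hg : g ≠ 0) {q : Ideal R} (hq : q ∈ associatedPrimes R (R ⧸ Ideal.span {g})) :
    ∃ c : R, c ≠ 0 ∧ ∀ y : K', IsIntegral R y →
      ∃ s ∉ q, s • c • y ∈ Submodule.span R (Set.range b) := by
  have := hq.1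
  let A := Localization.AtPrime q
  have hle := q.primeCompl_le_nonZeroDivisors
  have : IsDiscreteValuationRing A :=
    isDiscreteValuationRing_localization_of_mem_associatedPrimes hg hq
  let _ := IsLocalization.localizationAlgebraOfSubmonoidLe A K _ _ hle
  have := IsLocalization.localization_isScalarTower_of_submonoid_le A K _ _ hle
  have : IsFractionRing A K :=
    IsFractionRing.isFractionRing_of_isDomain_of_isLocalization q.primeCompl A K
  let _ : Algebra A K' := ((algebraMap K K').comp (algebraMap A K)).toAlgebra
  have : IsScalarTower A K K' := IsScalarTower.of_algebraMap_eq fun _ => rfl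
  have : IsScalarTower R A K' := .to₁₂₄ R A K K'
  have hA : HasGeometricallyRegularFormalFibers A := IsExcellentRing.formalFibers q A
  have := hA.finite_integralClosure_of_isDiscreteValuationRing K K'
  exact exists_ne_zero_forall_smul_mem_span_of_finite_localization (A := A) (M := q.primeCompl) b

theorem IsExcellentRing.finite_integralClosure (R : Type u) [CommRing R] [IsDomain R]
    [IsIntegrallyClosed R] [IsExcellentRing R]
    (K : Type v) [Field K] [Algebra R K] [IsFractionRing R K]
    (K' : Type w) [Field K'] [Algebra K K'] [FiniteDimensional K K']
    [Algebra R K'] [IsScalarTower R K K'] : Module.Finite R (integralClosure R K') := by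
  have : FaithfulSMul R K' := FaithfulSMul.trans R K K'
  obtain ⟨_, b, hb⟩ := FiniteDimensional.exists_is_basis_integral R K K'
  let F := Submodule.span R (Set.range b)
  have : Module.Free R F := .of_basis (.span (b.linearIndependent.restrict_scalars' R))
  have : Module.Finite R F := .span_of_finite R (Set.finite_range b)
  obtain ⟨g, hg0, hg⟩ := IsExcellentRing.exists_forall_pow_smul_mem_span b hb
  have hfin := associatedPrimes.finite R (R ⧸ Ideal.span {g})
  obtain ⟨c, hc0, hc⟩ := exists_ne_zero_forall_of_forall_exists
    (P := fun q (c : R) => ∀ y : K', IsIntegral R y → ∃ s ∉ q, s • c • y ∈ F) hfin.toFinset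
    (fun q c d h y hy => by
      obtain ⟨s, hs, hsy⟩ := h y hy
      exact ⟨s, hs, by rw [mul_smul, smul_comm s]; exact F.smul_mem d hsy⟩)
    fun q hq => IsExcellentRing.exists_forall_smul_mem_span_of_mem_associatedPrimes b hg0
      (hfin.mem_toFinset.1 hq)
  have hcF (y : integralClosure R K') : c • (y : K') ∈ F := by
    obtain ⟨n, hn⟩ := hg y y.2
    refine mem_of_pow_smul_mem_of_forall_mem_associatedPrimes hg0 n ?_ fun q hq =>
      hc q (hfin.mem_toFinset.2 hq) y y.2
    rw [smul_comm]
    exact F.smul_mem c hn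
  refine Module.Finite.of_injective
    (((LinearMap.lsmul R K' c).comp (integralClosure R K').val.toLinearMap).codRestrict F hcF)
    fun x y hxy => Subtype.ext (smul_right_injective K' hc0 (congrArg Subtype.val hxy))

end FiniteIntegralClosure

/-! ### The completion of a localization of the integral closure -/

section CompleteNoetherian

theorem exists_algHom_mvPowerSeries {B A σ : Type*} [CommRing B] [CommRing A] [Algebra B A]
    [Finite σ] (I : Ideal A) [IsAdicComplete I A] {a : σ → A} (ha : ∀ i, a i ∈ I) :
    ∃ F : MvPowerSeries σ B →ₐ[B] A, ∀ i, F (MvPowerSeries.X i) = a i := by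
  let J := MvPolynomial.idealOfVars σ B
  have hJ (m : ℕ) : J ^ m ≤ (I ^ m).comap (MvPolynomial.aeval a) := by
    rw [← Ideal.map_le_iff_le_comap, Ideal.map_pow]
    refine Ideal.pow_right_mono (Ideal.map_le_iff_le_comap.2 (Ideal.span_le.2 ?_)) m
    rintro _ ⟨i, rfl⟩
    simpa using ha i
  let f (m : ℕ) : MvPowerSeries σ B →ₐ[B] A ⧸ I ^ m :=
    (Ideal.quotientMapₐ (I ^ m) (MvPolynomial.aeval a) (hJ m)).comp
      ((MvPowerSeries.truncTotalAlgHom σ B m).restrictScalars B)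
  have hf {l m : ℕ} (hle : l ≤ m) :
      (Ideal.Quotient.factorₐ B (Ideal.pow_le_pow_right hle)).comp (f m) = f l := by
    ext p
    have hp := hJ l (MvPowerSeries.truncTotal_sub_truncTotal_mem_pow_idealOfVars hle le_rfl p)
    rwa [Ideal.mem_comap, map_sub, ← Ideal.Quotient.eq] at hp
  refine ⟨IsAdicComplete.liftAlgHom I f hf, fun i => ?_⟩
  rw [← sub_eq_zero]
  refine IsHausdorff.haus (inferInstance : IsHausdorff I A) _ fun m => ?_
  have hX : MvPowerSeries.truncTotalAlgHom σ B m (MvPowerSeries.X i) =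
      Ideal.Quotient.mk _ (MvPolynomial.X i) := by
    rw [← MvPolynomial.coe_X]
    exact (MvPowerSeries.truncTotalAlgHom σ B m).commutes (MvPolynomial.X i)
  rw [SModEq.zero, smul_eq_mul, Ideal.mul_top, ← Ideal.Quotient.eq_zero_iff_mem, map_sub,
    IsAdicComplete.mk_liftAlgHom, sub_eq_zero]
  change Ideal.quotientMapₐ _ _ (hJ m) (MvPowerSeries.truncTotalAlgHom σ B m _) = _
  rw [hX, Ideal.quotient_map_mkₐ]
  simp

theorem isNoetherianRing_of_isAdicComplete (B : Type*) {A : Type*} [CommRing B] [CommRing A]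
    [Algebra B A] [IsNoetherianRing B] (I : Ideal A) [IsAdicComplete I A] (hI : I.FG)
    (h : Function.Surjective (algebraMap B (A ⧸ I))) : IsNoetherianRing A := by
  obtain ⟨n, a, rfl⟩ := Submodule.fg_iff_exists_fin_generating_family.1 hI
  obtain ⟨F, hF⟩ := exists_algHom_mvPowerSeries (B := B) (Ideal.span (Set.range a))
    fun i => Ideal.subset_span (Set.mem_range_self i)
  let J : Ideal (MvPowerSeries (Fin n) B) := Ideal.span (Set.range MvPowerSeries.X)
  have hmap : J.map F.toRingHom = Ideal.span (Set.range a) := by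
    rw [Ideal.map_span, ← Set.range_comp]
    exact congrArg (Ideal.span ∘ Set.range) (funext hF)
  have : IsHausdorff (J.map F.toRingHom) A := hmap ▸ inferInstance
  refine isNoetherianRing_of_surjective _ _ F.toRingHom
    (surjective_of_mk_map_comp_surjective (I := J) F.toRingHom ?_)
  rw [hmap]
  intro y
  obtain ⟨b, rfl⟩ := h y
  exact ⟨algebraMap B _ b, congrArg (Ideal.Quotient.mk _) (F.commutes b)⟩

instance LocalCompletion.isNoetherianRing (R : Type u) [CommRing R] [IsLocalRing R]
    [IsNoetherianRing R] : IsNoetherianRing (LocalCompletion R) := by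
  refine isNoetherianRing_of_isAdicComplete R (maximalIdeal (LocalCompletion R)) ?_ fun y => ?_
  · rw [AdicCompletion.maximalIdeal_eq_map]
    exact Ideal.FG.map (maximalIdeal R).fg_of_isNoetherianRing _
  · obtain ⟨z, rfl⟩ := (AdicCompletion.residueField_map_bijective (R := R)).2 y
    obtain ⟨r, rfl⟩ := residue_surjective z
    exact ⟨r, rfl⟩

end CompleteNoetherian

section LocalizationOfIntegralClosure

theorem LiesOver.exists_isLocalization {R : Type u} {K' : Type v} {R' : Type w} [CommRing R]
    [Field K'] [CommRing R'] [Algebra R K'] [Algebra R' K'] [IsDomain R'] [IsFractionRing R' K']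
    [Algebra R R'] [IsScalarTower R R' K'] (h : LiesOver R K' R') :
    ∃ (n : Ideal (integralClosure R K')) (_ : n.IsMaximal) (f : integralClosure R K' →ₐ[R] R'),
      letI := f.toAlgebra
      IsScalarTower (integralClosure R K') R' K' ∧ IsLocalization.AtPrime R' n := by
  obtain ⟨n, hn, H⟩ := h
  let ι : R' →ₐ[R] K' := IsScalarTower.toAlgHom R R' K'
  have hι : Function.Injective ι := IsFractionRing.injective R' K'
  have coe_ne_zero {b : integralClosure R K'} (hb : b ∉ n) : (b : K') ≠ 0 := fun h0 =>
    hb ((Subtype.ext h0 : b = 0) ▸ n.zero_mem)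
  have coe_mem_range (a : integralClosure R K') : (a : K') ∈ ι.range :=
    (H a).2 ⟨a, 1, (Ideal.ne_top_iff_one n).1 hn.ne_top, by simp⟩
  let f : integralClosure R K' →ₐ[R] R' := (AlgEquiv.ofInjective ι hι).symm.toAlgHom.comp
    ((integralClosure R K').val.codRestrict _ coe_mem_range)
  have ι_f (a : integralClosure R K') : ι (f a) = a :=
    congrArg Subtype.val ((AlgEquiv.ofInjective ι hι).apply_symm_apply ⟨a, coe_mem_range a⟩)
  let _ := f.toAlgebra
  refine ⟨n, hn, f, IsScalarTower.of_algebraMap_eq fun a => (ι_f a).symm, ?_, ?_, ?_⟩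
  · rintro ⟨b, hb⟩
    obtain ⟨y, hy⟩ := (H (1 / (b : K'))).2 ⟨1, b, hb, by simp⟩
    refine IsUnit.of_mul_eq_one y (hι ?_)
    rw [map_mul, map_one]
    exact (congrArg₂ _ (ι_f b) hy).trans (mul_one_div_cancel (coe_ne_zero hb))
  · intro z
    obtain ⟨a, b, hb, hab⟩ := (H (ι z)).1 ⟨z, rfl⟩
    refine ⟨⟨a, b, hb⟩, hι ?_⟩
    rw [map_mul, hab]
    exact (congrArg _ (ι_f b)).trans ((div_mul_cancel₀ _ (coe_ne_zero hb)).trans (ι_f a).symm)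
  · intro a b hab
    refine ⟨1, ?_⟩
    rw [Subtype.ext ((ι_f a).symm.trans ((congrArg ι hab).trans (ι_f b)))]

variable {R : Type u} {S : Type v} {R' : Type w} [CommRing R] [IsLocalRing R]
  [CommRing S] [Algebra R S] [CommRing R'] [IsLocalRing R'] [Algebra R R']
  [Algebra S R'] [IsScalarTower R S R'] (n : Ideal S) [n.IsMaximal] [IsLocalization.AtPrime R' n]

include n

omit [CommRing R] [IsLocalRing R] [Algebra R S] [Algebra R R'] [IsScalarTower R S R'] in
theorem exists_sub_algebraMap_mem_maximalIdeal_pow (c : ℕ) (x : R') :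
    ∃ s : S, x - algebraMap S R' s ∈ maximalIdeal R' ^ c := by
  obtain ⟨y, hy⟩ := (IsLocalization.AtPrime.equivQuotMaximalIdealPow n R' c).surjective
    (Ideal.Quotient.mk _ x)
  obtain ⟨s, rfl⟩ := Ideal.Quotient.mk_surjective y
  rw [IsLocalization.AtPrime.equivQuotMaximalIdealPow_apply_mk] at hy
  exact ⟨s, Ideal.Quotient.eq.1 hy.symm⟩

theorem map_maximalIdeal_le_of_isLocalization_atPrime [Algebra.IsIntegral R S] :
    (maximalIdeal R).map (algebraMap R R') ≤ maximalIdeal R' := by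
  have hn : n.comap (algebraMap R S) = maximalIdeal R :=
    eq_maximalIdeal (Ideal.isMaximal_comap_of_isIntegral_of_isMaximal n)
  rw [IsScalarTower.algebraMap_eq R S R', ← Ideal.map_map,
    ← IsLocalization.AtPrime.map_eq_maximalIdeal n R', ← hn]
  exact Ideal.map_mono Ideal.map_comap_le

theorem exists_maximalIdeal_pow_le_map [IsNoetherianRing S] [Algebra.IsIntegral R S] :
    ∃ c, maximalIdeal R' ^ c ≤ (maximalIdeal R).map (algebraMap R R') := by
  have : IsNoetherianRing R' := IsLocalization.isNoetherianRing n.primeCompl R' inferInstance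
  refine Ideal.exists_pow_le_of_le_radical_of_fg ?_ (IsNoetherian.noetherian (maximalIdeal R'))
  rw [Ideal.radical_eq_sInf]
  refine le_sInf fun J ⟨hJ, hJp⟩ => ?_
  have hJR : (J.comap (algebraMap S R')).comap (algebraMap R S) = maximalIdeal R := by
    refine ((maximalIdeal.isMaximal R).eq_of_le (Ideal.IsPrime.ne_top inferInstance) ?_).symm
    rwa [Ideal.comap_comap, ← IsScalarTower.algebraMap_eq, ← Ideal.map_le_iff_le_comap]
  have hJmax : (J.comap (algebraMap S R')).IsMaximal :=
    Ideal.isMaximal_of_isIntegral_of_isMaximal_comap (R := R) _ (hJR ▸ maximalIdeal.isMaximal R)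
  have hJn : J.comap (algebraMap S R') ≤ n := by
    rw [← IsLocalization.AtPrime.under_maximalIdeal R' n]
    exact Ideal.comap_mono (le_maximalIdeal hJp.ne_top)
  rw [← IsLocalization.AtPrime.map_eq_maximalIdeal n R', Ideal.map_le_iff_le_comap,
    hJmax.eq_of_le (Ideal.IsPrime.ne_top inferInstance) hJn]

end LocalizationOfIntegralClosure

section AdicApproximation

variable {R : Type*} [CommRing R] {I : Ideal R}

theorem exists_sub_algebraMap_mem_map_pow (hI : I.FG) (c : ℕ) (x : AdicCompletion I R) :
    ∃ r : R, x - algebraMap R (AdicCompletion I R) r ∈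
      (I ^ c).map (algebraMap R (AdicCompletion I R)) := by
  obtain ⟨r, hr⟩ := Ideal.Quotient.mk_surjective (AdicCompletion.eval I R c x)
  have hker : x - algebraMap R (AdicCompletion I R) r ∈
      LinearMap.ker (AdicCompletion.eval I R c) := by
    rw [LinearMap.mem_ker, map_sub, ← hr, sub_eq_zero]
    rfl
  rw [← AdicCompletion.pow_smul_top_eq_ker_eval hI] at hker
  exact ⟨r, (Ideal.smul_top_eq_map (S := AdicCompletion I R) (I ^ c)).le hker⟩

theorem exists_sub_one_tmul_mem_map_pow {S : Type*} [CommRing S] [Algebra R S] (hI : I.FG) (c : ℕ)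
    (y : AdicCompletion I R ⊗[R] S) :
    ∃ s : S, y - 1 ⊗ₜ s ∈ (I ^ c).map (algebraMap R (AdicCompletion I R ⊗[R] S)) := by
  induction y using TensorProduct.induction_on with
  | zero => exact ⟨0, by simp⟩
  | add x y hx hy =>
    obtain ⟨s, hs⟩ := hx
    obtain ⟨t, ht⟩ := hy
    exact ⟨s + t, by rw [TensorProduct.tmul_add, add_sub_add_comm]; exact add_mem hs ht⟩
  | tmul a s =>
    obtain ⟨r, hr⟩ := exists_sub_algebraMap_mem_map_pow hI c a
    have hsub : a ⊗ₜ[R] s - 1 ⊗ₜ[R] (r • s) =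
        algebraMap _ (AdicCompletion I R ⊗[R] S) (a - algebraMap R _ r) * 1 ⊗ₜ s := by
      rw [← TensorProduct.smul_tmul, ← TensorProduct.sub_tmul, Algebra.smul_def, mul_one,
        Algebra.TensorProduct.algebraMap_apply, Algebra.TensorProduct.tmul_mul_tmul, mul_one,
        one_mul, Algebra.algebraMap_self_apply]
    refine ⟨r • s, hsub ▸ Ideal.mul_mem_right _ _ ?_⟩
    rw [IsScalarTower.algebraMap_eq R (AdicCompletion I R), ← Ideal.map_map]
    exact Ideal.mem_map_of_mem _ hr

end AdicApproximation

/-- Krull's intersection theorem, read in the localization at the preimage of the maximal ideal. -/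
theorem exists_isUnit_mul_eq_zero_of_forall_mem_pow_comap {T B : Type*} [CommRing T]
    [IsNoetherianRing T] [CommRing B] [IsLocalRing B] (f : T →+* B) {z : T}
    (hz : ∀ c, z ∈ (maximalIdeal B).comap f ^ c) : ∃ t, IsUnit (f t) ∧ t * z = 0 := by
  obtain ⟨r, hr⟩ := (Ideal.mem_iInf_smul_pow_eq_bot_iff ((maximalIdeal B).comap f) z).1
    (Submodule.mem_iInf _ |>.2 fun c => by simpa using hz c)
  refine ⟨1 - r, ?_, by rw [sub_mul, one_mul]; exact sub_eq_zero.2 hr.symm⟩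
  rw [map_sub, map_one]
  exact (isUnit_or_isUnit_one_sub_self (f r)).resolve_left r.2

section CompletionOfLocalization

variable {R : Type u} {S : Type v} {R' : Type w} [CommRing R] [IsLocalRing R] [IsNoetherianRing R]
  [CommRing S] [Algebra R S] [Module.Finite R S] [CommRing R'] [IsLocalRing R']
  [IsNoetherianRing R'] [Algebra R R']
  [Algebra S R'] [IsScalarTower R S R'] (n : Ideal S) [n.IsMaximal] [IsLocalization.AtPrime R' n]
  [Algebra (LocalCompletion R) (LocalCompletion R')]
  [IsScalarTower R (LocalCompletion R) (LocalCompletion R')]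

omit [IsNoetherianRing R'] in
theorem map_maximalIdeal_localCompletion :
    (maximalIdeal (LocalCompletion R)).map
        (algebraMap (LocalCompletion R) (LocalCompletion R')) =
      (((maximalIdeal R).map (algebraMap R R')).map (algebraMap R' (LocalCompletion R'))) := by
  rw [AdicCompletion.maximalIdeal_eq_map, Ideal.map_map, Ideal.map_map,
    ← IsScalarTower.algebraMap_eq, ← IsScalarTower.algebraMap_eq]

include n

theorem map_maximalIdeal_localCompletion_ne_top :
    (maximalIdeal (LocalCompletion R)).map
        (algebraMap (LocalCompletion R) (LocalCompletion R')) ≠ ⊤ := by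
  refine ne_top_of_le_ne_top (maximalIdeal.isMaximal (LocalCompletion R')).ne_top ?_
  rw [map_maximalIdeal_localCompletion, AdicCompletion.maximalIdeal_eq_map (R := R')]
  exact Ideal.map_mono (map_maximalIdeal_le_of_isLocalization_atPrime n)

theorem exists_sub_algebraMap_mem_map_maximalIdeal (x : LocalCompletion R') :
    ∃ s : S, x - algebraMap S (LocalCompletion R') s ∈
      (maximalIdeal (LocalCompletion R)).map
        (algebraMap (LocalCompletion R) (LocalCompletion R')) := by
  have : IsNoetherianRing S := isNoetherian_of_tower R inferInstance
  obtain ⟨c, hc⟩ := exists_maximalIdeal_pow_le_map (R := R) (R' := R') n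
  obtain ⟨y, hy⟩ :=
    exists_sub_algebraMap_mem_map_pow (maximalIdeal R').fg_of_isNoetherianRing c x
  obtain ⟨s, hs⟩ := exists_sub_algebraMap_mem_maximalIdeal_pow (R' := R') n c y
  refine ⟨s, ?_⟩
  rw [map_maximalIdeal_localCompletion, ← sub_add_sub_cancel x (algebraMap R' _ y),
    IsScalarTower.algebraMap_apply S R', ← map_sub]
  exact add_mem (Ideal.map_mono hc hy) (Ideal.mem_map_of_mem _ (hc hs))

theorem moduleFinite_localCompletion :
    Module.Finite (LocalCompletion R) (LocalCompletion R') := by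
  obtain ⟨t, ht⟩ := Module.Finite.fg_top (R := R) (M := S)
  let I := maximalIdeal (LocalCompletion R)
  have : IsHausdorff I (LocalCompletion R') := by
    rw [← IsHausdorff.map_algebraMap_iff (S := LocalCompletion R')]
    exact IsHausdorff.of_isLocalRing _ _ (map_maximalIdeal_localCompletion_ne_top n)
  let f : S →ₐ[R] LocalCompletion R' := IsScalarTower.toAlgHom R S (LocalCompletion R')
  have f_mem_span (s : S) : f s ∈ Submodule.span (LocalCompletion R) (f '' t) := by
    have hs := Submodule.mem_map_of_mem (f := f.toLinearMap) (ht ▸ Submodule.mem_top : s ∈ _)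
    rw [Submodule.map_span] at hs
    exact Submodule.span_le_restrictScalars R (LocalCompletion R) _ hs
  refine moduleFinite_of_isPrecomplete I (Submodule.fg_span (t.finite_toSet.image f))
    (eq_top_iff.2 fun x _ => ?_)
  obtain ⟨s, hs⟩ := exists_sub_algebraMap_mem_map_maximalIdeal (R := R) n x
  rw [← add_sub_cancel (f s) x]
  refine Submodule.add_mem_sup (f_mem_span s) ?_
  rw [Ideal.smul_top_eq_map]
  exact hs

/-- The comparison map `R̂ ⊗ S → R̂'` from the base change of `S` to the completion of a
localization `R'` of `S`. -/
noncomputable def completionComparison (R : Type u) (S : Type v) (R' : Type w)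
    [CommRing R] [IsLocalRing R] [CommRing S] [Algebra R S] [CommRing R'] [IsLocalRing R']
    [Algebra R R'] [Algebra S R'] [IsScalarTower R S R']
    [Algebra (LocalCompletion R) (LocalCompletion R')]
    [IsScalarTower R (LocalCompletion R) (LocalCompletion R')] :
    LocalCompletion R ⊗[R] S →ₐ[LocalCompletion R] LocalCompletion R' :=
  Algebra.TensorProduct.lift (Algebra.ofId (LocalCompletion R) (LocalCompletion R'))
    (IsScalarTower.toAlgHom R S (LocalCompletion R')) fun _ _ => Commute.all _ _

omit n in
omit [IsNoetherianRing R] [Module.Finite R S] [IsNoetherianRing R'] in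
theorem completionComparison_one_tmul (s : S) :
    completionComparison R S R' (1 ⊗ₜ s) = algebraMap S (LocalCompletion R') s := by
  simp [completionComparison]

theorem completionComparison_surjective :
    Function.Surjective (completionComparison R S R') := by
  have := moduleFinite_localCompletion (R := R) (R' := R') n
  let Φ := (completionComparison R S R').toLinearMap
  suffices h : ⊤ ≤ LinearMap.range Φ from LinearMap.range_eq_top.1 (eq_top_iff.2 h)
  refine Submodule.le_of_le_smul_of_le_jacobson_bot (I := maximalIdeal (LocalCompletion R))
    Module.Finite.fg_top (maximalIdeal_le_jacobson _) fun x _ => ?_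
  obtain ⟨s, hs⟩ := exists_sub_algebraMap_mem_map_maximalIdeal (R := R) n x
  rw [← add_sub_cancel (algebraMap S _ s) x]
  refine Submodule.add_mem_sup ⟨1 ⊗ₜ s, completionComparison_one_tmul s⟩ ?_
  rw [Ideal.smul_top_eq_map]
  exact hs

omit [IsNoetherianRing R] [Module.Finite R S] in
theorem completionComparison_one_tmul_mem_maximalIdeal_pow_iff {s : S} {c : ℕ} :
    completionComparison R S R' (1 ⊗ₜ s) ∈ maximalIdeal (LocalCompletion R') ^ c ↔ s ∈ n ^ c := by
  rw [completionComparison_one_tmul, IsScalarTower.algebraMap_apply S R',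
    AdicCompletion.maximalIdeal_eq_map, ← Ideal.map_pow, ← Ideal.mem_comap,
    Ideal.comap_map_eq_self_of_faithfullyFlat, ← Ideal.mem_comap]
  exact Ideal.ext_iff.1 (IsLocalization.AtPrime.under_maximalIdeal_pow n R' c) s

theorem exists_mul_eq_zero_of_completionComparison_eq_zero
    {z : LocalCompletion R ⊗[R] S} (hz : completionComparison R S R' z = 0) :
    ∃ t, IsUnit (completionComparison R S R' t) ∧ t * z = 0 := by
  let Φ := completionComparison R S R'
  let M : Ideal (LocalCompletion R ⊗[R] S) := (maximalIdeal (LocalCompletion R')).comap Φ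
  have : IsNoetherianRing (LocalCompletion R ⊗[R] S) :=
    isNoetherian_of_tower (LocalCompletion R) inferInstance
  have hnM : n.map (Algebra.TensorProduct.includeRight : S →ₐ[R] LocalCompletion R ⊗[R] S) ≤ M :=
    Ideal.map_le_iff_le_comap.2 fun s hs => by
      have hs' := (completionComparison_one_tmul_mem_maximalIdeal_pow_iff (R := R) (R' := R') n).2
        ((pow_one n).symm ▸ hs)
      rwa [pow_one] at hs'
  have hmM : (maximalIdeal R).map (algebraMap R (LocalCompletion R ⊗[R] S)) ≤ M := by
    have hmn : (maximalIdeal R).map (algebraMap R S) ≤ n := Ideal.map_le_iff_le_comap.2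
      (eq_maximalIdeal (Ideal.isMaximal_comap_of_isIntegral_of_isMaximal n)).ge
    rw [← AlgHom.comp_algebraMap (Algebra.TensorProduct.includeRight :
      S →ₐ[R] LocalCompletion R ⊗[R] S), ← Ideal.map_map]
    exact (Ideal.map_mono hmn).trans hnM
  refine exists_isUnit_mul_eq_zero_of_forall_mem_pow_comap Φ.toRingHom fun c => ?_
  obtain ⟨s, hs⟩ :=
    exists_sub_one_tmul_mem_map_pow (maximalIdeal R).fg_of_isNoetherianRing c z
  rw [Ideal.map_pow] at hs
  have hzs : z - 1 ⊗ₜ s ∈ M ^ c := Ideal.pow_right_mono hmM c hs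
  have hΦs : Φ (1 ⊗ₜ s) ∈ maximalIdeal (LocalCompletion R') ^ c := by
    rw [← neg_mem_iff, ← zero_sub, ← hz, ← map_sub]
    refine Ideal.pow_right_mono (Ideal.map_comap_le (f := Φ)) c ?_
    exact Ideal.map_pow Φ M c ▸ Ideal.mem_map_of_mem Φ hzs
  have hsn : s ∈ n ^ c := (completionComparison_one_tmul_mem_maximalIdeal_pow_iff n).1 hΦs
  rw [← sub_add_cancel z (1 ⊗ₜ s)]
  refine add_mem hzs (Ideal.pow_right_mono hnM c ?_)
  rw [← Ideal.map_pow]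
  exact Ideal.mem_map_of_mem _ hsn

end CompletionOfLocalization

section CompletionDomain

variable {R : Type u} {S : Type*} {R' : Type*} [CommRing R] [IsDomain R] [IsLocalRing R]
  [IsNoetherianRing R] [CommRing S] [IsDomain S] [IsIntegrallyClosed S] [Algebra R S]
  [Module.Finite R S] [CommRing R'] [IsLocalRing R'] [IsNoetherianRing R'] [Algebra R R']
  [Algebra S R'] [IsScalarTower R S R'] (n : Ideal S) [n.IsMaximal] [IsLocalization.AtPrime R' n]
  [Algebra (LocalCompletion R) (LocalCompletion R')]
  [IsScalarTower R (LocalCompletion R) (LocalCompletion R')]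
  (K : Type v) [Field K] [Algebra R K] [IsFractionRing R K]
  (K' : Type w) [Field K'] [Algebra K K'] [FiniteDimensional K K']
  [Algebra R K'] [IsScalarTower R K K'] [Algebra S K'] [IsFractionRing S K'] [IsScalarTower R S K']

include K K' n

theorem HasGeometricallyRegularFormalFibers.isDomain_localCompletion_localization
    (h : HasGeometricallyRegularFormalFibers R) : IsDomain (LocalCompletion R') := by
  have : NoZeroDivisors (LocalCompletion R') := ⟨by
    intro a b hab
    obtain ⟨x, rfl⟩ := completionComparison_surjective (R := R) n a
    obtain ⟨y, rfl⟩ := completionComparison_surjective (R := R) n b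
    rw [← map_mul] at hab
    obtain ⟨t, ht, htxy⟩ := exists_mul_eq_zero_of_completionComparison_eq_zero n hab
    rw [← mul_assoc] at htxy
    let e := Algebra.TensorProduct.comm R (LocalCompletion R) S
    obtain ⟨i, -, hix, hiy⟩ := h.exists_isIdempotentElem_of_mul_eq_zero_tensorProduct K K' S
      (x := e (t * x)) (y := e y) (by rw [← map_mul, htxy, map_zero])
    let Ψ := (completionComparison R S R').toRingHom.comp e.symm.toRingEquiv.toRingHom
    have hΨ (z) : Ψ (e z) = completionComparison R S R' z := by simp [Ψ]
    have hΨx := congrArg Ψ hix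
    have hΨy := congrArg Ψ hiy
    rw [map_mul, hΨ, map_zero, map_mul] at hΨx
    rw [map_mul, hΨ] at hΨy
    rcases isUnit_or_isUnit_one_sub_self (Ψ i) with hu | hu
    · exact Or.inl (ht.mul_right_eq_zero.1 (hu.mul_right_eq_zero.1 hΨx))
    · exact Or.inr (hu.mul_right_eq_zero.1 (by rw [sub_mul, one_mul, hΨy, sub_self]))⟩
  exact NoZeroDivisors.to_isDomain _

omit [IsDomain R] [IsDomain S] [IsIntegrallyClosed S] [FiniteDimensional K K'] in
theorem LocalCompletion.algebraMap_injective_of_isLocalization [IsDomain (LocalCompletion R)] :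
    Function.Injective (algebraMap (LocalCompletion R) (LocalCompletion R')) := by
  refine (injective_iff_map_eq_zero _).2 fun a ha => by_contra fun ha0 => ?_
  obtain ⟨t, ht, hta⟩ := exists_mul_eq_zero_of_completionComparison_eq_zero (R' := R') n
    (z := algebraMap (LocalCompletion R) (LocalCompletion R ⊗[R] S) a)
    (by rw [AlgHom.commutes, ha])
  have : Module.Flat R K := IsLocalization.flat K (nonZeroDivisors R)
  have : Module.Flat R K' := Module.Flat.trans R K K'
  let ψ := (IsScalarTower.toAlgHom R S K').toLinearMap.baseChange (LocalCompletion R)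
  have ψ_injective : Function.Injective ψ :=
    Module.Flat.lTensor_preserves_injective_linearMap _ (IsFractionRing.injective S K')
  have ha_regular : IsSMulRegular (LocalCompletion R ⊗[R] K') a :=
    Module.Flat.isSMulRegular_of_nonZeroDivisors (mem_nonZeroDivisors_of_ne_zero ha0)
  have ψ_t : ψ t = 0 := ha_regular.right_eq_zero_of_smul <| by
    rw [← map_smul, Algebra.smul_def, mul_comm, hta, map_zero]
  rw [ψ_injective (ψ_t.trans (map_zero ψ).symm), map_zero] at ht
  exact not_isUnit_zero ht

end CompletionDomain

/-! ### Degrees of extensions of local rings -/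

section PrimitiveElement

variable {F E : Type*} [Field F] [Field E] [Algebra F E] [FiniteDimensional F E] {x : E}

theorem adjoin_singleton_eq_top_of_natDegree_minpoly_eq_finrank
    (hx : (minpoly F x).natDegree = Module.finrank F E) : Algebra.adjoin F {x} = ⊤ := by
  rw [← IntermediateField.adjoin_simple_toSubalgebra_of_isAlgebraic
    (Algebra.IsAlgebraic.isAlgebraic x),
    (Field.primitive_element_iff_minpoly_natDegree_eq F x).2 hx, IntermediateField.top_toSubalgebra]

theorem isSeparable_of_aeval_derivative_minpoly_ne_zero
    (hx : Polynomial.aeval x (minpoly F x).derivative ≠ 0) : IsSeparable F x := by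
  rw [IsSeparable, Polynomial.separable_iff_derivative_ne_zero
    (minpoly.irreducible (Algebra.IsIntegral.isIntegral x))]
  exact fun h => hx (by rw [h, map_zero])

omit [FiniteDimensional F E] in
theorem algebraIsSeparable_of_adjoin_singleton_eq_top (hx : IsSeparable F x)
    (htop : Algebra.adjoin F {x} = ⊤) : Algebra.IsSeparable F E := by
  refine (separableClosure.eq_top_iff F E).1 (eq_top_iff.2 fun y _ => ?_)
  have hxs : x ∈ separableClosure F E := mem_separableClosure_iff.2 hx
  exact Algebra.adjoin_le (S := (separableClosure F E).toSubalgebra)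
    (Set.singleton_subset_iff.2 hxs) (htop ▸ Algebra.mem_top : y ∈ Algebra.adjoin F {x})

theorem exists_isSeparable_natDegree_minpoly_eq_finSepDegree (k k' : Type*) [Field k] [Field k']
    [Algebra k k'] [FiniteDimensional k k'] :
    ∃ x : k', IsSeparable k x ∧ (minpoly k x).natDegree = Field.finSepDegree k k' := by
  obtain ⟨x, hx⟩ := Field.exists_primitive_element k (separableClosure k k')
  refine ⟨x, mem_separableClosure_iff.1 x.2, ?_⟩
  have hmin : minpoly k (x : k') = minpoly k x :=
    minpoly.algebraMap_eq (algebraMap (separableClosure k k') k').injective x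
  rw [Field.finSepDegree_eq, Field.sepDegree, ← Module.finrank, hmin,
    ← IntermediateField.adjoin.finrank (Algebra.IsIntegral.isIntegral x), hx,
    IntermediateField.finrank_top']

/-- By Euler's formula, the trace dual of `A[x]` is `A[x]` divided by the value at `x` of the
derivative of the minimal polynomial of `x`; the dual contains all the integral elements. -/
theorem aeval_derivative_minpoly_mul_mem_adjoin_of_isIntegral {A : Type*} [CommRing A] [IsDomain A]
    [IsIntegrallyClosed A] [Algebra A F] [IsFractionRing A F] [Algebra A E] [IsScalarTower A F E]
    (hx : IsIntegral A x) (hsep : IsSeparable F x) (htop : Algebra.adjoin F {x} = ⊤)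
    {y : E} (hy : IsIntegral A y) :
    Polynomial.aeval x (minpoly F x).derivative * y ∈ Algebra.adjoin A {x} := by
  have : Algebra.IsSeparable F E := algebraIsSeparable_of_adjoin_singleton_eq_top hsep htop
  have hdual : y ∈ (Algebra.traceForm F E).dualSubmodule
      (Subalgebra.toSubmodule (Algebra.adjoin A {x})) := fun z hz => by
    rw [Algebra.traceForm_apply, Submodule.mem_one]
    exact IsIntegrallyClosed.isIntegral_iff.1
      (Algebra.isIntegral_trace (hy.mul (adjoin_le_integralClosure hx hz)))
  rw [traceForm_dualSubmodule_adjoin A F htop hx] at hdual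
  obtain ⟨z, hz, rfl⟩ := hdual
  simpa [hsep.aeval_derivative_ne_zero (minpoly.aeval F x)] using hz

end PrimitiveElement

section FractionFieldOfFinite

theorem isLocalization_algebraMapSubmonoid_of_finite (A : Type*) {C : Type*} (E' : Type*)
    [CommRing A] [IsDomain A] [CommRing C] [IsDomain C] [Algebra A C] [Module.Finite A C]
    [FaithfulSMul A C] [Field E'] [Algebra C E'] [IsFractionRing C E'] :
    IsLocalization (Algebra.algebraMapSubmonoid C (nonZeroDivisors A)) E' := by
  refine (IsLocalization.iff_of_le_of_exists_dvd _ (nonZeroDivisors C) ?_ ?_).2 inferInstance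
  · rintro _ ⟨x, hx, rfl⟩
    exact mem_nonZeroDivisors_of_ne_zero
      ((map_ne_zero_iff _ (FaithfulSMul.algebraMap_injective A C)).2 (nonZeroDivisors.ne_zero hx))
  · intro c hc
    obtain ⟨a, ha, hca⟩ := (Algebra.IsAlgebraic.isAlgebraic (R := A) c).exists_nonzero_dvd hc
    exact ⟨_, ⟨a, mem_nonZeroDivisors_of_ne_zero ha, rfl⟩, hca⟩

variable (A C E E' : Type*) [CommRing A] [IsDomain A] [CommRing C] [IsDomain C]
  [Algebra A C] [Module.Finite A C] [FaithfulSMul A C] [Field E] [Algebra A E] [IsFractionRing A E]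
  [Field E'] [Algebra C E'] [IsFractionRing C E'] [Algebra E E'] [Algebra A E']
  [IsScalarTower A E E'] [IsScalarTower A C E']

include A C in
theorem moduleFinite_of_isFractionRing : Module.Finite E E' := by
  have := isLocalization_algebraMapSubmonoid_of_finite A (C := C) E'
  exact .of_isLocalization A C (nonZeroDivisors A)

variable {C} in
theorem finrank_le_card_of_span_eq_top {ι : Type*} [Fintype ι] (b : ι → C)
    (hb : Submodule.span A (Set.range b) = ⊤) : Module.finrank E E' ≤ Fintype.card ι := by
  have := isLocalization_algebraMapSubmonoid_of_finite A (C := C) E'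
  have hspan := span_eq_top_localization_localization E (nonZeroDivisors A) E' hb
  rw [← Set.range_comp] at hspan
  exact finrank_le_of_span_eq_top hspan

variable {C} [IsIntegrallyClosed A] (θ : C)

omit [FaithfulSMul A C] [IsFractionRing C E'] in
theorem natDegree_minpoly_algebraMap :
    (minpoly E (algebraMap C E' θ)).natDegree = (minpoly A θ).natDegree := by
  have hθ : IsIntegral A θ := Algebra.IsIntegral.isIntegral θ
  rw [minpoly.isIntegrallyClosed_eq_field_fractions E E' hθ, (minpoly.monic hθ).natDegree_map]

theorem natDegree_minpoly_le_finrank : (minpoly A θ).natDegree ≤ Module.finrank E E' := by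
  have : Module.Finite E E' := moduleFinite_of_isFractionRing A C E E'
  exact natDegree_minpoly_algebraMap A E E' θ ▸ minpoly.natDegree_le _

theorem adjoin_singleton_eq_top_of_isUnit_aeval_derivative
    (hθ : (minpoly A θ).natDegree = Module.finrank E E')
    (hunit : IsUnit (Polynomial.aeval θ (minpoly A θ).derivative)) :
    Algebra.adjoin A {θ} = ⊤ := by
  have : Module.Finite E E' := moduleFinite_of_isFractionRing A C E E'
  have isIntegral (c : C) : IsIntegral A (algebraMap C E' c) :=
    (Algebra.IsIntegral.isIntegral (R := A) c).algebraMap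
  have hder : Polynomial.aeval (algebraMap C E' θ) (minpoly E (algebraMap C E' θ)).derivative =
      algebraMap C E' (Polynomial.aeval θ (minpoly A θ).derivative) := by
    rw [minpoly.isIntegrallyClosed_eq_field_fractions E E'
      (Algebra.IsIntegral.isIntegral (R := A) θ), Polynomial.derivative_map,
      Polynomial.aeval_map_algebraMap, Polynomial.aeval_algebraMap_apply]
  have hsep : IsSeparable E (algebraMap C E' θ) :=
    isSeparable_of_aeval_derivative_minpoly_ne_zero (hder ▸ (hunit.map (algebraMap C E')).ne_zero)
  have htop : Algebra.adjoin E {algebraMap C E' θ} = ⊤ :=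
    adjoin_singleton_eq_top_of_natDegree_minpoly_eq_finrank
      ((natDegree_minpoly_algebraMap A E E' θ).trans hθ)
  refine eq_top_iff.2 fun c _ => ?_
  obtain ⟨u, hu⟩ := hunit
  have hmem := aeval_derivative_minpoly_mul_mem_adjoin_of_isIntegral (isIntegral θ) hsep htop
    (isIntegral (↑u⁻¹ * c))
  rw [hder, ← map_mul, ← hu, Units.mul_inv_cancel_left, ← IsScalarTower.coe_toAlgHom' A C E',
    ← AlgHom.map_adjoin_singleton] at hmem
  obtain ⟨z, hz, hzc⟩ := hmem
  rwa [← IsFractionRing.injective C E' hzc]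

end FractionFieldOfFinite

section LocalExtensionDegree

theorem algebraMap_eq_zero_iff_mem_maximalIdeal {A k : Type*} [CommRing A] [IsLocalRing A]
    [Field k] [Algebra A k] (hk : Function.Surjective (algebraMap A k)) (a : A) :
    algebraMap A k a = 0 ↔ a ∈ maximalIdeal A := by
  rw [← eq_maximalIdeal (RingHom.ker_isMaximal_of_surjective _ hk), RingHom.mem_ker]

variable (A C k k' : Type*) [CommRing A] [CommRing C] [Algebra A C] [Field k] [Field k']
  [Algebra A k] [Algebra C k'] [Algebra k k'] [Algebra A k'] [IsScalarTower A k k']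
  [IsScalarTower A C k']

include A in
theorem moduleFinite_of_surjective_algebraMap [Module.Finite A C]
    (hk' : Function.Surjective (algebraMap C k')) : Module.Finite k k' := by
  have : Module.Finite A k' := .of_surjective (IsScalarTower.toAlgHom A C k').toLinearMap hk'
  exact .of_restrictScalars_finite A k k'

variable {A C}

theorem aeval_algebraMap_map_algebraMap (p : Polynomial A) (θ : C) :
    Polynomial.aeval (algebraMap C k' θ) (p.map (algebraMap A k)) =
      algebraMap C k' (Polynomial.aeval θ p) := by
  rw [Polynomial.aeval_map_algebraMap, Polynomial.aeval_algebraMap_apply]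

theorem minpoly_dvd_map_minpoly (θ : C) :
    minpoly k (algebraMap C k' θ) ∣ (minpoly A θ).map (algebraMap A k) :=
  minpoly.dvd _ _ (by rw [aeval_algebraMap_map_algebraMap, minpoly.aeval, map_zero])

theorem adjoin_singleton_algebraMap_eq_top (hk' : Function.Surjective (algebraMap C k')) {θ : C}
    (hθ : Algebra.adjoin A {θ} = ⊤) : Algebra.adjoin k {algebraMap C k' θ} = ⊤ := by
  refine eq_top_iff.2 fun y _ => ?_
  obtain ⟨c, rfl⟩ := hk' y
  obtain ⟨p, rfl⟩ := (AlgHom.range_eq_top _).1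
    ((Algebra.adjoin_singleton_eq_range_aeval A θ).symm.trans hθ) c
  rw [← aeval_algebraMap_map_algebraMap k]
  exact Polynomial.aeval_mem_adjoin_singleton k _

variable [IsLocalRing A] [IsLocalRing C]
  (hk : Function.Surjective (algebraMap A k)) (hk' : Function.Surjective (algebraMap C k'))

include hk hk'

theorem span_range_eq_top_of_map_maximalIdeal_eq [Module.Finite A C]
    (hm : (maximalIdeal A).map (algebraMap A C) = maximalIdeal C) {ι : Type*} (b : ι → C)
    (hb : Submodule.span k (Set.range (algebraMap C k' ∘ b)) = ⊤) :
    Submodule.span A (Set.range b) = ⊤ := by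
  refine eq_top_iff.2 <| Submodule.le_of_le_smul_of_le_jacobson_bot (I := maximalIdeal A)
    Module.Finite.fg_top (maximalIdeal_le_jacobson _) fun c _ => ?_
  have hc : algebraMap C k' c ∈ (Submodule.span A (Set.range b)).map
      (IsScalarTower.toAlgHom A C k').toLinearMap := by
    rw [Submodule.map_span, ← Set.range_comp, ← SetLike.mem_coe]
    have hspan := Submodule.coe_span_eq_span_of_surjective A k hk (Set.range (algebraMap C k' ∘ b))
    rw [hb, Submodule.top_coe] at hspan
    exact hspan ▸ Set.mem_univ _
  obtain ⟨y, hy, hyc⟩ := hc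
  have hcy : c - y ∈ maximalIdeal C := by
    rw [← algebraMap_eq_zero_iff_mem_maximalIdeal hk', map_sub, sub_eq_zero]
    exact hyc.symm
  rw [← add_sub_cancel y c]
  refine Submodule.add_mem_sup hy ?_
  rw [Ideal.smul_top_eq_map, hm]
  exact hcy

theorem map_maximalIdeal_eq_of_adjoin_singleton_eq_top {θ : C} (hθ : Algebra.adjoin A {θ} = ⊤)
    (hmin : (minpoly A θ).map (algebraMap A k) = minpoly k (algebraMap C k' θ)) :
    (maximalIdeal A).map (algebraMap A C) = maximalIdeal C := by
  refine le_antisymm (Ideal.map_le_iff_le_comap.2 fun a ha => ?_) fun c hc => ?_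
  · rw [Ideal.mem_comap, ← algebraMap_eq_zero_iff_mem_maximalIdeal hk',
      ← IsScalarTower.algebraMap_apply, IsScalarTower.algebraMap_apply A k k',
      (algebraMap_eq_zero_iff_mem_maximalIdeal hk a).2 ha, map_zero]
  obtain ⟨p, rfl⟩ := (AlgHom.range_eq_top _).1
    ((Algebra.adjoin_singleton_eq_range_aeval A θ).symm.trans hθ) c
  rw [← algebraMap_eq_zero_iff_mem_maximalIdeal hk', ← aeval_algebraMap_map_algebraMap k] at hc
  obtain ⟨q, hq⟩ := minpoly.dvd _ _ hc
  obtain ⟨q, rfl⟩ := Polynomial.map_surjective _ hk q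
  have hpq : (p - minpoly A θ * q).map (algebraMap A k) = 0 := by
    rw [Polynomial.map_sub, Polynomial.map_mul, hmin, hq, sub_self]
  have haeval : Polynomial.aeval θ p = Polynomial.aeval θ (p - minpoly A θ * q) := by
    rw [map_sub, map_mul, minpoly.aeval, zero_mul, sub_zero]
  rw [haeval, Polynomial.aeval_eq_sum_range]
  refine Ideal.sum_mem _ fun i _ => ?_
  rw [Algebra.smul_def]
  refine Ideal.mul_mem_right _ _ (Ideal.mem_map_of_mem _ ?_)
  rw [← algebraMap_eq_zero_iff_mem_maximalIdeal hk, ← Polynomial.coeff_map, hpq,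
    Polynomial.coeff_zero]

omit [IsLocalRing A] hk in
theorem isUnit_aeval_derivative_minpoly {θ : C} (hsep : IsSeparable k (algebraMap C k' θ))
    (hmin : (minpoly A θ).map (algebraMap A k) = minpoly k (algebraMap C k' θ)) :
    IsUnit (Polynomial.aeval θ (minpoly A θ).derivative) := by
  rw [← notMem_maximalIdeal, ← algebraMap_eq_zero_iff_mem_maximalIdeal hk',
    ← aeval_algebraMap_map_algebraMap k, ← Polynomial.derivative_map, hmin]
  exact hsep.aeval_derivative_ne_zero (minpoly.aeval _ _)

variable [Module.Finite A C] [IsDomain A] [IsDomain C] [IsIntegrallyClosed A] [FaithfulSMul A C]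
  (E E' : Type*) [Field E] [Algebra A E] [IsFractionRing A E]
  [Field E'] [Algebra C E'] [IsFractionRing C E'] [Algebra E E'] [Algebra A E']
  [IsScalarTower A E E'] [IsScalarTower A C E']

omit [IsLocalRing A] [IsLocalRing C] hk hk' in
theorem natDegree_minpoly_residue_le_finrank (θ : C) :
    (minpoly k (algebraMap C k' θ)).natDegree ≤ (minpoly A θ).natDegree ∧
      (minpoly A θ).natDegree ≤ Module.finrank E E' := by
  have hmonic := minpoly.monic (Algebra.IsIntegral.isIntegral (R := A) θ)
  refine ⟨?_, natDegree_minpoly_le_finrank A E E' θ⟩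
  rw [← hmonic.natDegree_map (algebraMap A k)]
  exact Polynomial.natDegree_le_of_dvd (minpoly_dvd_map_minpoly k k' θ) (hmonic.map _).ne_zero

variable (A) in
include A in
omit [IsLocalRing A] [IsLocalRing C] hk in
theorem finSepDegree_le_finrank_of_isFractionRing :
    Field.finSepDegree k k' ≤ Module.finrank E E' := by
  have : Module.Finite k k' := moduleFinite_of_surjective_algebraMap A C k k' hk'
  obtain ⟨x, -, hx⟩ := exists_isSeparable_natDegree_minpoly_eq_finSepDegree k k'
  obtain ⟨θ, rfl⟩ := hk' x
  obtain ⟨hle, hle'⟩ := natDegree_minpoly_residue_le_finrank (A := A) k k' E E' θ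
  exact hx ▸ hle.trans hle'

theorem finrank_eq_finSepDegree_of_map_maximalIdeal_eq
    (hm : (maximalIdeal A).map (algebraMap A C) = maximalIdeal C) [Algebra.IsSeparable k k'] :
    Module.finrank E E' = Field.finSepDegree k k' := by
  have : Module.Finite k k' := moduleFinite_of_surjective_algebraMap A C k k' hk'
  refine le_antisymm ?_ (finSepDegree_le_finrank_of_isFractionRing A k k' hk' E E')
  let b := Module.finBasis k k'
  choose c hc using fun i => hk' (b i)
  have hspan : Submodule.span k (Set.range (algebraMap C k' ∘ c)) = ⊤ :=
    (congrArg (fun f => Submodule.span k (Set.range f)) (funext hc)).trans b.span_eq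
  rw [Field.finSepDegree_eq_finrank_of_isSeparable, ← Fintype.card_fin (Module.finrank k k')]
  exact finrank_le_card_of_span_eq_top A E E' c
    (span_range_eq_top_of_map_maximalIdeal_eq k k' hk hk' hm c hspan)

theorem map_maximalIdeal_eq_of_finrank_eq_finSepDegree
    (h : Module.finrank E E' = Field.finSepDegree k k') :
    (maximalIdeal A).map (algebraMap A C) = maximalIdeal C ∧ Algebra.IsSeparable k k' := by
  have : Module.Finite k k' := moduleFinite_of_surjective_algebraMap A C k k' hk'
  obtain ⟨x, hsep, hx⟩ := exists_isSeparable_natDegree_minpoly_eq_finSepDegree k k'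
  obtain ⟨θ, rfl⟩ := hk' x
  obtain ⟨hle, hle'⟩ := natDegree_minpoly_residue_le_finrank (A := A) k k' E E' θ
  have hdeg : (minpoly A θ).natDegree = Module.finrank E E' :=
    le_antisymm hle' (h ▸ hx ▸ hle)
  have hmonic := minpoly.monic (Algebra.IsIntegral.isIntegral (R := A) θ)
  have hmin : (minpoly A θ).map (algebraMap A k) = minpoly k (algebraMap C k' θ) :=
    Polynomial.eq_of_monic_of_dvd_of_natDegree_le
      (minpoly.monic (Algebra.IsIntegral.isIntegral _)) (hmonic.map _)
      (minpoly_dvd_map_minpoly k k' θ) (by rw [hmonic.natDegree_map, hdeg, h, hx])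
  have htop : Algebra.adjoin A {θ} = ⊤ := adjoin_singleton_eq_top_of_isUnit_aeval_derivative A E E'
    θ hdeg (isUnit_aeval_derivative_minpoly k k' hk' hsep hmin)
  exact ⟨map_maximalIdeal_eq_of_adjoin_singleton_eq_top k k' hk hk' htop hmin,
    algebraIsSeparable_of_adjoin_singleton_eq_top hsep
      (adjoin_singleton_algebraMap_eq_top k k' hk' htop)⟩

end LocalExtensionDegree

namespace LocalCompletion

section ResidueField

variable (R : Type u) [CommRing R] [IsLocalRing R] [IsNoetherianRing R]

/-- The residue map of the completion of a local ring, with values in the residue field of the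
ring itself. -/
noncomputable def toResidueField : LocalCompletion R →+* ResidueField R :=
  (RingEquiv.ofBijective _ (AdicCompletion.residueField_map_bijective R)).symm.toRingHom.comp
    (residue _)

theorem toResidueField_algebraMap (r : R) :
    toResidueField R (algebraMap R (LocalCompletion R) r) = residue R r := by
  rw [toResidueField, RingHom.comp_apply, ← ResidueField.map_residue]
  exact (RingEquiv.ofBijective _ (AdicCompletion.residueField_map_bijective R)).symm_apply_apply
    (residue R r)

theorem toResidueField_surjective : Function.Surjective (toResidueField R) :=
  (RingEquiv.ofBijective _
    (AdicCompletion.residueField_map_bijective R)).symm.surjective.comp residue_surjective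

theorem toResidueField_eq_zero_iff (x : LocalCompletion R) :
    toResidueField R x = 0 ↔ x ∈ maximalIdeal (LocalCompletion R) :=
  let _ := (toResidueField R).toAlgebra
  algebraMap_eq_zero_iff_mem_maximalIdeal (toResidueField_surjective R) x

end ResidueField

variable (R : Type u) (R' : Type v) [CommRing R] [CommRing R'] [IsLocalRing R] [IsLocalRing R']
  [IsNoetherianRing R] [IsNoetherianRing R'] [Algebra R R'] [IsLocalHom (algebraMap R R')]

theorem map_completionMap_maximalIdeal_le :
    (maximalIdeal (LocalCompletion R)).map (completionMap R R') ≤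
      maximalIdeal (LocalCompletion R') := by
  have hcomp : (completionMap R R').comp (algebraMap R (LocalCompletion R)) =
      (algebraMap R' (LocalCompletion R')).comp (algebraMap R R') :=
    RingHom.ext (completionMap_algebraMap R R')
  rw [AdicCompletion.maximalIdeal_eq_map, AdicCompletion.maximalIdeal_eq_map, Ideal.map_map, hcomp,
    ← Ideal.map_map]
  exact Ideal.map_mono (((local_hom_TFAE (algebraMap R R')).out 0 2 rfl rfl).mp inferInstance)

theorem toResidueField_completionMap (x : LocalCompletion R) :
    toResidueField R' (completionMap R R' x) =
      algebraMap (ResidueField R) (ResidueField R') (toResidueField R x) := by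
  obtain ⟨r, hr⟩ := residue_surjective (toResidueField R x)
  have hxr : x - algebraMap R (LocalCompletion R) r ∈ maximalIdeal (LocalCompletion R) := by
    rw [← toResidueField_eq_zero_iff, map_sub, toResidueField_algebraMap, hr, sub_self]
  have hmem := map_completionMap_maximalIdeal_le R R' (Ideal.mem_map_of_mem _ hxr)
  rw [← toResidueField_eq_zero_iff, map_sub, map_sub, sub_eq_zero, completionMap_algebraMap,
    toResidueField_algebraMap] at hmem
  rw [hmem, ← hr, ResidueField.algebraMap_residue]

end LocalCompletion

section FiniteCompletion

theorem completionFractionMap_algebraMap {R : Type u} {R' : Type v} [CommRing R] [CommRing R']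
    [IsLocalRing R] [IsLocalRing R'] [Algebra R R'] [IsLocalHom (algebraMap R R')]
    [IsDomain (LocalCompletion R)] [IsDomain (LocalCompletion R')]
    (h : Function.Injective (completionMap R R')) (x : LocalCompletion R) :
    completionFractionMap h (algebraMap _ _ x) = algebraMap _ _ (completionMap R R' x) :=
  IsLocalization.map_eq (M := nonZeroDivisors (LocalCompletion R))
    (T := nonZeroDivisors (LocalCompletion R')) (g := completionMap R R')
    (nonZeroDivisors_le_comap_nonZeroDivisors_of_injective _ h) x

variable {R : Type u} {R' : Type v} [CommRing R] [CommRing R'] [IsLocalRing R] [IsLocalRing R']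
  [IsNoetherianRing R] [IsNoetherianRing R'] [Algebra R R'] [IsLocalHom (algebraMap R R')]

theorem map_maximalIdeal_completionMap_eq_iff :
    (maximalIdeal (LocalCompletion R)).map (completionMap R R') =
        maximalIdeal (LocalCompletion R') ↔
      (maximalIdeal R).map (algebraMap R R') = maximalIdeal R' := by
  let _ : Algebra (LocalCompletion R) (LocalCompletion R') := (completionMap R R').toAlgebra
  have : IsScalarTower R (LocalCompletion R) (LocalCompletion R') := .of_algebraMap_eq fun r => by
    rw [IsScalarTower.algebraMap_apply R R' (LocalCompletion R')]
    exact (completionMap_algebraMap R R' r).symm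
  rw [← RingHom.algebraMap_toAlgebra (completionMap R R'), map_maximalIdeal_localCompletion,
    AdicCompletion.maximalIdeal_eq_map]
  refine ⟨fun h => ?_, fun h => by rw [h]⟩
  rw [← Ideal.comap_map_eq_self_of_faithfullyFlat (B := LocalCompletion R')
    ((maximalIdeal R).map (algebraMap R R')), h, Ideal.comap_map_eq_self_of_faithfullyFlat]

theorem moduleFinite_residueField_of_finite_completionMap (hfin : (completionMap R R').Finite) :
    Module.Finite (ResidueField R) (ResidueField R') := by
  have hcomp : (LocalCompletion.toResidueField R').comp (completionMap R R') =
      (algebraMap (ResidueField R) (ResidueField R')).comp (LocalCompletion.toResidueField R) :=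
    RingHom.ext (LocalCompletion.toResidueField_completionMap R R')
  have hfin_comp : ((LocalCompletion.toResidueField R').comp (completionMap R R')).Finite :=
    .comp (.of_surjective _ (LocalCompletion.toResidueField_surjective R')) hfin
  exact RingHom.finite_algebraMap.1 (.of_comp_finite (hcomp ▸ hfin_comp))

variable [IsDomain (LocalCompletion R)] [IsDomain (LocalCompletion R')]
  (hinj : Function.Injective (completionMap R R')) (hfin : (completionMap R R').Finite)

include hfin

omit [IsNoetherianRing R] [IsNoetherianRing R'] in
theorem completionFractionMap_finite : (completionFractionMap hinj).Finite := by
  let _ := (completionMap R R').toAlgebra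
  let _ := (completionFractionMap hinj).toAlgebra
  have : Module.Finite (LocalCompletion R) (LocalCompletion R') := hfin
  have : FaithfulSMul (LocalCompletion R) (LocalCompletion R') :=
    (faithfulSMul_iff_algebraMap_injective _ _).2 hinj
  have : IsScalarTower (LocalCompletion R) (FractionRing (LocalCompletion R))
      (FractionRing (LocalCompletion R')) :=
    .of_algebraMap_eq fun r => (completionFractionMap_algebraMap hinj r).symm
  exact moduleFinite_of_isFractionRing (LocalCompletion R) (LocalCompletion R') _ _

theorem isUnramifiedLocalExtension_iff_ramificationRatio_eq_one
    [IsIntegrallyClosed (LocalCompletion R)] :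
    IsUnramifiedLocalExtension R R' ↔ ramificationRatio hinj = 1 := by
  let _ := (completionMap R R').toAlgebra
  let _ := (completionFractionMap hinj).toAlgebra
  let _ := (LocalCompletion.toResidueField R).toAlgebra
  let _ := (LocalCompletion.toResidueField R').toAlgebra
  let _ := ((LocalCompletion.toResidueField R').comp (completionMap R R')).toAlgebra
  have : Module.Finite (LocalCompletion R) (LocalCompletion R') := hfin
  have : FaithfulSMul (LocalCompletion R) (LocalCompletion R') :=
    (faithfulSMul_iff_algebraMap_injective _ _).2 hinj
  have : IsScalarTower (LocalCompletion R) (FractionRing (LocalCompletion R))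
      (FractionRing (LocalCompletion R')) :=
    .of_algebraMap_eq fun r => (completionFractionMap_algebraMap hinj r).symm
  have : IsScalarTower (LocalCompletion R) (LocalCompletion R') (ResidueField R') :=
    .of_algebraMap_eq fun _ => rfl
  have : IsScalarTower (LocalCompletion R) (ResidueField R) (ResidueField R') :=
    .of_algebraMap_eq (LocalCompletion.toResidueField_completionMap R R')
  have hres := moduleFinite_residueField_of_finite_completionMap hfin
  have hk := LocalCompletion.toResidueField_surjective R
  have hk' := LocalCompletion.toResidueField_surjective R'
  have hg : (residueSeparableDegree R R' : ℚ) ≠ 0 :=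
    Nat.cast_ne_zero.2 (NeZero.ne (Field.finSepDegree (ResidueField R) (ResidueField R')))
  rw [ramificationRatio, div_eq_one_iff_eq hg, Nat.cast_inj, IsUnramifiedLocalExtension,
    ← map_maximalIdeal_completionMap_eq_iff]
  constructor
  · rintro ⟨hm, -, hsep⟩
    exact finrank_eq_finSepDegree_of_map_maximalIdeal_eq _ _ hk hk'
      (FractionRing (LocalCompletion R)) (FractionRing (LocalCompletion R')) hm
  · intro h
    obtain ⟨hm, hsep⟩ := map_maximalIdeal_eq_of_finrank_eq_finSepDegree _ _ hk hk'
      (FractionRing (LocalCompletion R)) (FractionRing (LocalCompletion R')) h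
    exact ⟨hm, hres, hsep⟩

end FiniteCompletion

section LiesOver

variable {R : Type u} [CommRing R] [IsDomain R] [IsLocalRing R] [IsNoetherianRing R]
  {K : Type v} [Field K] [Algebra R K] [IsFractionRing R K]
  {K' : Type w} [Field K'] [Algebra K K'] [FiniteDimensional K K']
  [Algebra R K'] [IsScalarTower R K K'] [Module.Finite R (integralClosure R K')]
  {R' : Type*} [CommRing R'] [IsDomain R'] [IsLocalRing R']
  [Algebra R' K'] [IsFractionRing R' K'] [Algebra R R'] [IsScalarTower R R' K']

omit [IsDomain R] [IsLocalRing R] [IsLocalRing R'] in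
theorem LiesOver.isNoetherianRing (hR' : LiesOver R K' R') : IsNoetherianRing R' := by
  obtain ⟨n, _, f, -, _⟩ := hR'.exists_isLocalization
  let _ := f.toAlgebra
  have : IsNoetherianRing (integralClosure R K') := isNoetherian_of_tower R inferInstance
  exact IsLocalization.isNoetherianRing n.primeCompl R' inferInstance

variable (K) in
include K in
theorem LiesOver.isDomain_and_finite_and_injective_completionMap (hR' : LiesOver R K' R')
    [IsLocalHom (algebraMap R R')] [IsIntegrallyClosed R]
    (hR : HasGeometricallyRegularFormalFibers R) :
    IsDomain (LocalCompletion R') ∧ (completionMap R R').Finite ∧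
      Function.Injective (completionMap R R') := by
  let S := integralClosure R K'
  have : IsFractionRing S K' := integralClosure.isFractionRing_of_finite_extension K K'
  have : IsIntegrallyClosed S := integralClosure.isIntegrallyClosedOfFiniteExtension K
  obtain ⟨n, _, f, _, _⟩ := hR'.exists_isLocalization
  have := hR'.isNoetherianRing
  have : IsDomain (LocalCompletion R) := hR.isDomain_localCompletion
  let _ : Algebra S R' := f.toAlgebra
  have : IsScalarTower R S R' := .of_algebraMap_eq fun r => (f.commutes r).symm
  let _ : Algebra (LocalCompletion R) (LocalCompletion R') := (completionMap R R').toAlgebra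
  have : IsScalarTower R (LocalCompletion R) (LocalCompletion R') := .of_algebraMap_eq fun r => by
    rw [IsScalarTower.algebraMap_apply R R' (LocalCompletion R')]
    exact (completionMap_algebraMap R R' r).symm
  exact ⟨hR.isDomain_localCompletion_localization n K K',
    moduleFinite_localCompletion (R := R) (R' := R') n,
    LocalCompletion.algebraMap_injective_of_isLocalization n K K'⟩

end LiesOver

theorem IsExcellentRing.hasGeometricallyRegularFormalFibers (R : Type u) [CommRing R]
    [IsLocalRing R] [IsExcellentRing R] : HasGeometricallyRegularFormalFibers R :=
  have : IsLocalization.AtPrime R (maximalIdeal R) := IsLocalization.self fun x hx => by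
    simpa only [IsUnit.mem_submonoid_iff, Ideal.mem_primeCompl_iff, notMem_maximalIdeal] using hx
  IsExcellentRing.formalFibers (maximalIdeal R) R

theorem proposition4p4_general
    {R : Type u} [CommRing R] [IsDomain R] [IsLocalRing R] [IsIntegrallyClosed R]
    [IsNoetherianRing R] (hR : HasGeometricallyRegularFormalFibers R)
    {K : Type v} [Field K] [Algebra R K] [IsFractionRing R K]
    {K' : Type w} [Field K'] [Algebra K K'] [FiniteDimensional K K']
    [Algebra R K'] [IsScalarTower R K K'] [Module.Finite R (integralClosure R K')]
    {R' : Type*} [CommRing R'] [IsDomain R'] [IsLocalRing R']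
    [Algebra R' K'] [IsFractionRing R' K']
    [Algebra R R'] [IsScalarTower R R' K']
    (hR' : LiesOver R K' R') :
    haveI : IsLocalHom (algebraMap R R') := hR'.isLocalHom
    ∃ (_ : IsDomain (LocalCompletion R)) (_ : IsDomain (LocalCompletion R'))
      (h : Function.Injective (completionMap R R')),
      (completionFractionMap h).Finite ∧
      Module.Finite (ResidueField R) (ResidueField R') ∧
      (IsUnramifiedLocalExtension R R' ↔ ramificationRatio h = 1) := by
  have := hR'.isLocalHom
  have := hR'.isNoetherianRing
  have hdom : IsDomain (LocalCompletion R) := hR.isDomain_localCompletion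
  have := hR.isIntegrallyClosed_localCompletion
  obtain ⟨hdom', hfin, hinj⟩ := hR'.isDomain_and_finite_and_injective_completionMap K hR
  exact ⟨hdom, hdom', hinj, completionFractionMap_finite hinj hfin,
    moduleFinite_residueField_of_finite_completionMap hfin,
    isUnramifiedLocalExtension_iff_ramificationRatio_eq_one hinj hfin⟩

theorem proposition4p4
    {R : Type u} [CommRing R] [IsDomain R] [IsLocalRing R] [IsIntegrallyClosed R]
    [IsExcellentRing R]
    {K : Type v} [Field K] [Algebra R K] [IsFractionRing R K]
    {K' : Type w} [Field K'] [Algebra K K'] [FiniteDimensional K K']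
    [Algebra R K'] [IsScalarTower R K K']
    {R' : Type*} [CommRing R'] [IsDomain R'] [IsLocalRing R'] [IsIntegrallyClosed R']
    [Algebra R' K'] [IsFractionRing R' K']
    [Algebra R R'] [IsScalarTower R R' K']
    (hR' : LiesOver R K' R') :
    haveI : IsLocalHom (algebraMap R R') := hR'.isLocalHom
    ∃ (_ : IsDomain (LocalCompletion R)) (_ : IsDomain (LocalCompletion R'))
      (h : Function.Injective (completionMap R R')),
      (completionFractionMap h).Finite ∧
      Module.Finite (ResidueField R) (ResidueField R') ∧
      (IsUnramifiedLocalExtension R R' ↔ ramificationRatio h = 1) := by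
  have := IsExcellentRing.finite_integralClosure R K K'
  exact proposition4p4_general (IsExcellentRing.hasGeometricallyRegularFormalFibers R) (K := K) hR'
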